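/- Let $(W,\{s_i\}_{i\in I})$ be an arbitrary Coxeter system with Coxeter matrix $(m_{ij})_{i,j\in I}$, with length function $\ell$ and Bruhat order $\leqslant$, and let $K\subset I$. For $J\subset I$ let $W_J=\langle s_j\mid j\in J\rangle$ and let $W^J$ be the set of minimal-length representatives of the cosets in $W/W_J$. Let ${}^J\!\leqslant$ be the $J$-twisted Bruhat order on $W$, i.e. the reflexive and transitive relation generated by $tw\;{}^J\!\!<w$ for $w\in W$ and $t$ a reflection such that either $t\notin W_J$ and $\ell(tw)<\ell(w)$, or $t\in W_J$ and $\ell(tw)>\ell(w)$. Let $Q_K=\{(v,w)\in W\times W^K\mid v\leqslant w\}$, with $(v',w')\preceq(v,w)$ if there is $u\in W_K$ such that $v\leqslant v'u\leqslant w'u\leqslant w$. Let $\tilde I=I^\flat\cup I^\sharp$ be the union of two copies $I^\flat=\{i^\flat\mid i\in I\}$ and $I^\sharp=\{i^\sharp\mid i\in I\}$ of $I$, glued along $K$, so that $I^\flat\cap I^\sharp=\{k^\flat=k^\sharp\mid k\in K\}$. Let $\tilde W$ be the Coxeter group with index set $\tilde I$ and Coxeter matrix $\tilde m_{i^\flat,j^\flat}=\tilde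 m_{i^\sharp,j^\sharp}=m_{ij}$ for $i,j\in I$, and $\tilde m_{i^\flat,j^\sharp}=\tilde m_{j^\sharp,i^\flat}=2$ for $i,j\in I\setminus K$. Let $w\mapsto w^\flat$ and $w\mapsto w^\sharp$ be the homomorphisms $W\to\tilde W$ with $s_i^\flat=s_{i^\flat}$ and $s_i^\sharp=s_{i^\sharp}$. Define $$\tilde\nu:Q_K\to\tilde W,\qquad \tilde\nu(v,w)=v^\flat(w^{-1})^\sharp .$$ Then $(Q_K,\preceq)$ and $(\tilde W,{}^{I^\flat}\!\leqslant)$ are partially ordered sets, and: 1. $\tilde\nu$ is an isomorphism of posets from $(Q_K,\preceq)$ onto $(\tilde\nu(Q_K),{}^{I^\flat}\!\leqslant)$; that is, $\tilde\nu$ is injective, and $(v',w')\preceq(v,w)$ if and only if $\tilde\nu(v',w')\;{}^{I^\flat}\!\leqslant\tilde\nu(v,w)$. 2. $\tilde\nu(Q_K)=\{\tilde w\in\tilde W_{I^\flat}\tilde W_{I^\sharp}\mid r^\flat(r^{-1})^\sharp\;{}^{I^\flat}\!\leqslant\tilde w\text{ for some }r\in W^K\}$. 3. $\tilde\nu(Q_K)$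 is a convex subset of $(\tilde W,{}^{I^\flat}\!\leqslant)$: if $x,y\in\tilde\nu(Q_K)$ and $x\;{}^{I^\flat}\!\leqslant z\;{}^{I^\flat}\!\leqslant y$, then $z\in\tilde\nu(Q_K)$. -/

import Mathlib

noncomputable section

namespace CoxeterAtlas

open scoped Classical

universe u v

/-! ### Parabolic subgroups, minimal coset representatives and Bruhat orders -/

section Orders

variable {B : Type u} {W : Type v} [Group W] {M : CoxeterMatrix B}

/-- The standard parabolic subgroup `W_J`, generated by the simple reflections in `J`. -/
def parabolic (cs : CoxeterSystem M W) (J : Set B) : Subgroup W :=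
  Subgroup.closure (cs.simple '' J)

/-- The set `W^J` of minimal-length representatives of the cosets `w W_J`. -/
def minReps (cs : CoxeterSystem M W) (J : Set B) : Set W :=
  {w | ∀ u ∈ parabolic cs J, cs.length w ≤ cs.length (w * u)}

/-- The Bruhat order `u ≤ w`: the reflexive and transitive relation generated by
`t b < b` for `b` in `W` and `t` a reflection with `ℓ(t b) < ℓ(b)`. -/
def BruhatLE (cs : CoxeterSystem M W) : W → W → Prop :=
  Relation.ReflTransGen fun a b =>
    ∃ t, cs.IsReflection t ∧ a = t * b ∧ cs.length (t * b) < cs.length b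

/-- The generating relation `t b ᴶ< b` of the `J`-twisted Bruhat order.

In terms of roots it reads `s_β b ᴶ< b` whenever `b⁻¹(β)` is a negative root, where `β` is either
a positive root outside the root system of `W_J` or a negative root of `W_J`. Write `t = s_β`.
The reflection `t` lies in `W_J` exactly when `β` is a root of `W_J`. For `β` positive, `b⁻¹(β)` is
negative exactly when `ℓ(t b) < ℓ(b)`; for `β` negative, exactly when `ℓ(t b) > ℓ(b)`. -/
def TwistedStep (cs : CoxeterSystem M W) (J : Set B) (a b : W) : Prop :=
  ∃ t, cs.IsReflection t ∧ a = t * b ∧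
    ((t ∉ parabolic cs J ∧ cs.length (t * b) < cs.length b) ∨
      (t ∈ parabolic cs J ∧ cs.length b < cs.length (t * b)))

/-- The `J`-twisted Bruhat order `ᴶ≤` on `W`. -/
def TwistedLE (cs : CoxeterSystem M W) (J : Set B) : W → W → Prop :=
  Relation.ReflTransGen (TwistedStep cs J)

/-- `Q_K = {(v, w) ∈ W × W^K | v ≤ w}`. -/
def Q (cs : CoxeterSystem M W) (K : Set B) : Type v :=
  {p : W × W // p.2 ∈ minReps cs K ∧ BruhatLE cs p.1 p.2}

/-- The relation `(v', w') ⪯ (v, w)` on `Q_K`: there is `u ∈ W_K` with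
`v ≤ v' u ≤ w' u ≤ w`. -/
def QLE (cs : CoxeterSystem M W) (K : Set B) (p' p : Q cs K) : Prop :=
  ∃ u ∈ parabolic cs K,
    BruhatLE cs p.1.1 (p'.1.1 * u) ∧ BruhatLE cs (p'.1.1 * u) (p'.1.2 * u) ∧
      BruhatLE cs (p'.1.2 * u) p.1.2

end Orders

/-! ### The doubled Coxeter system -/

section Double

variable {B : Type u} (K : Set B)

/-- Two copies of `B` glued along `K`: the first copy, together with the elements of the second
copy that do not lie in `K`. -/
abbrev Double : Type u := B ⊕ {i : B // i ∉ K}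

/-- The first copy `i ↦ i♭`. -/
def flatIdx (i : B) : Double K := Sum.inl i

/-- The second copy `i ↦ i♯`; it agrees with the first one on `K`. -/
def sharpIdx (i : B) : Double K := if h : i ∈ K then Sum.inl i else Sum.inr ⟨i, h⟩

/-- The folding map `i♭ ↦ i`, `i♯ ↦ i`. -/
def natIdx : Double K → B := Sum.elim id Subtype.val

/-- The subset `I♭`. -/
def flatSet : Set (Double K) := Set.range (flatIdx K)

/-- The subset `I♯`. -/
def sharpSet : Set (Double K) := Set.range (sharpIdx K)

theorem natIdx_flatIdx (i : B) : natIdx K (flatIdx K i) = i := rfl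

theorem natIdx_sharpIdx (i : B) : natIdx K (sharpIdx K i) = i := by
  unfold sharpIdx
  split_ifs <;> rfl

theorem flatIdx_eq_sharpIdx_iff (i j : B) : flatIdx K i = sharpIdx K j ↔ i = j ∧ j ∈ K := by
  unfold flatIdx sharpIdx
  split_ifs with h <;> simp [h]

/-- The Coxeter matrix on the glued index set: it restricts to the given matrix on each of the two
copies, and an element outside `I♭` commutes with an element outside `I♯`. -/
def doubleMatrix (M : CoxeterMatrix B) : CoxeterMatrix (Double K) where
  M := Matrix.of fun a b =>
    if (a ∈ flatSet K ∧ b ∈ flatSet K) ∨ (a ∈ sharpSet K ∧ b ∈ sharpSet K) then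
      M (natIdx K a) (natIdx K b)
    else 2
  isSymm := by
    ext a b
    simp only [Matrix.transpose_apply, Matrix.of_apply]
    exact if_congr (or_congr and_comm and_comm) (M.symmetric (natIdx K b) (natIdx K a)) rfl
  diagonal := by
    rintro (i | i)
    · simp [flatSet, flatIdx]
    · have h : (Sum.inr i : Double K) ∈ sharpSet K := ⟨i.1, by simp [sharpIdx, i.2]⟩
      simp [h]
  off_diagonal := by
    intro a b hab
    simp only [Matrix.of_apply]
    split_ifs with h
    · apply M.off_diagonal
      rcases h with ⟨⟨i, rfl⟩, ⟨j, rfl⟩⟩ | ⟨⟨i, rfl⟩, ⟨j, rfl⟩⟩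
      · rintro hij
        rw [natIdx_flatIdx, natIdx_flatIdx] at hij
        exact hab (by rw [hij])
      · rintro hij
        rw [natIdx_sharpIdx, natIdx_sharpIdx] at hij
        exact hab (by rw [hij])
    · norm_num

variable (M : CoxeterMatrix B)

theorem doubleMatrix_flat (i j : B) :
    doubleMatrix K M (flatIdx K i) (flatIdx K j) = M i j := by
  simp [doubleMatrix, flatSet, natIdx_flatIdx]

theorem doubleMatrix_sharp (i j : B) :
    doubleMatrix K M (sharpIdx K i) (sharpIdx K j) = M i j := by
  simp [doubleMatrix, sharpSet, natIdx_sharpIdx]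

theorem doubleMatrix_flat_sharp {i j : B} (hi : i ∉ K) (hj : j ∉ K) :
    doubleMatrix K M (flatIdx K i) (sharpIdx K j) = 2 := by
  have h1 : sharpIdx K j ∉ flatSet K := by
    rintro ⟨a, ha⟩
    exact hj ((flatIdx_eq_sharpIdx_iff K a j).1 ha).2
  have h2 : flatIdx K i ∉ sharpSet K := by
    rintro ⟨a, ha⟩
    obtain ⟨rfl, h⟩ := (flatIdx_eq_sharpIdx_iff K i a).1 ha.symm
    exact hi h
  simp [doubleMatrix, h1, h2]

/-- The Coxeter group `W̃` of the doubled Coxeter matrix. -/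
abbrev DoubleGroup : Type u := (doubleMatrix K M).Group

/-- The Coxeter system of `W̃`. -/
abbrev doubleSystem : CoxeterSystem (doubleMatrix K M) (DoubleGroup K M) :=
  (doubleMatrix K M).toCoxeterSystem

variable {M} {W : Type v} [Group W] (cs : CoxeterSystem M W)

/-- The homomorphism `w ↦ w♭` from `W` to `W̃` with `s_i ↦ s_{i♭}`. -/
def flat : W →* DoubleGroup K M :=
  cs.lift ⟨fun i => (doubleSystem K M).simple (flatIdx K i), fun i j => by
    have h := (doubleSystem K M).simple_mul_simple_pow (flatIdx K i) (flatIdx K j)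
    rwa [doubleMatrix_flat] at h⟩

/-- The homomorphism `w ↦ w♯` from `W` to `W̃` with `s_i ↦ s_{i♯}`. -/
def sharp : W →* DoubleGroup K M :=
  cs.lift ⟨fun i => (doubleSystem K M).simple (sharpIdx K i), fun i j => by
    have h := (doubleSystem K M).simple_mul_simple_pow (sharpIdx K i) (sharpIdx K j)
    rwa [doubleMatrix_sharp] at h⟩

/-- The map `(v, w) ↦ v♭ (w⁻¹)♯` from `Q_K` to `W̃`. -/
def nu (p : Q cs K) : DoubleGroup K M :=
  flat K cs p.1.1 * sharp K cs (p.1.2)⁻¹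

/-- The order `I♭≤` on `W̃`. -/
abbrev DoubleLE : DoubleGroup K M → DoubleGroup K M → Prop :=
  TwistedLE (doubleSystem K M) (flatSet K)

end Double

end CoxeterAtlas

end

/-! Write `pairElt v w` for v♭(w⁻¹)♯ and let w range over W^K, with v arbitrary. On such pairs
`PairLE` is ⪯ without its middle inequality, which holds automatically on Q_K (`qle_iff_pairLE`).
The core of the proof is `doubleLE_iff_pairLE`: on these elements the twisted order is exactly
`PairLE`.

For w in W^K the element (w⁻¹)♯ is shortest in its left coset of W̃_{I♭} (`isLeftMin_sharp`). A
downward step by a reflection in W̃_{I♭} therefore lengthens v. In a downward step by any other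
reflection, its conjugate by (v♭)⁻¹ is an inversion of (w⁻¹)♯, so it comes from W and replaces w by
some wτ < w; writing wτ = zu with z in W^K and u in W_K, the factor u crosses over to v because u♭ =
u♯ (`exists_of_twistedStep`). Conversely, `BruhatLE.exists_mul_inv_le` and `BruhatLE.rightLE` turn a
`PairLE` relation into twisted steps.

The condition v ≤ w says that (v, w) lies above some (r, r), which describes the image. Everything
below a `pairElt` is again a `pairElt`, which gives convexity. Antisymmetry comes from the strictly
monotone `twistedLength`.

Underneath lie the cocycle property of inversions, strong exchange, and `length_map`: both maps W →
W̃ preserve length. The last rests on s_i s_j having order exactly m_ij, read off from the geometric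
representation. -/

namespace CoxeterSystem

/-! ### Inversion parity, the cocycle property and strong exchange. -/

variable {B W : Type*} [Group W] {M : CoxeterMatrix B} (cs : CoxeterSystem M W)

open scoped Classical in
/-- The action of a simple reflection on `W × ZMod 2` that conjugates the first component and
records whether it equals the simple reflection. -/
noncomputable def parityStep (i : B) : Function.End (W × ZMod 2) := fun p =>
  (cs.simple i * p.1 * cs.simple i, p.2 + if p.1 = cs.simple i then 1 else 0)

open scoped Classical in
theorem parityStep_mul_pow (i j : B) (k : ℕ) (t : W) (e : ZMod 2) :
    ((cs.parityStep i * cs.parityStep j) ^ k) (t, e) =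
      ((cs.simple i * cs.simple j) ^ k * t * ((cs.simple i * cs.simple j) ^ k)⁻¹,
        e + ∑ n ∈ Finset.range (2 * k),
          if t = ((cs.simple i * cs.simple j) ^ n)⁻¹ * cs.simple j then 1 else 0) := by
  set p := cs.simple i * cs.simple j with hp
  have hj : cs.simple j * p = p⁻¹ * cs.simple j := by simp [hp, mul_assoc]
  have hjn (n : ℕ) : cs.simple j * p ^ n = (p ^ n)⁻¹ * cs.simple j := by
    rw [← inv_pow]
    exact ((show SemiconjBy (cs.simple j) p p⁻¹ from hj).pow_right n)
  induction k with
  | zero => simp; rfl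
  | succ k ih =>
    rw [pow_succ']
    change cs.parityStep i (cs.parityStep j (((cs.parityStep i * cs.parityStep j) ^ k) (t, e))) = _
    rw [ih]
    simp only [parityStep, mul_add, mul_one, Finset.sum_range_succ, Prod.mk.injEq]
    constructor
    · rw [pow_succ' p k, mul_inv_rev]
      simp [hp, mul_assoc]
    · have h1 : p ^ k * t * (p ^ k)⁻¹ = cs.simple j ↔ t = (p ^ (2 * k))⁻¹ * cs.simple j := by
        rw [mul_inv_eq_iff_eq_mul, hjn, ← eq_inv_mul_iff_mul_eq, ← mul_assoc, ← mul_inv_rev,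
          ← pow_add, two_mul]
      have h2 : cs.simple j * (p ^ k * t * (p ^ k)⁻¹) * cs.simple j = cs.simple i ↔
          t = (p ^ (2 * k + 1))⁻¹ * cs.simple j := by
        have : cs.simple j * (p ^ k * t * (p ^ k)⁻¹) * cs.simple j = cs.simple i ↔
            p ^ k * t * (p ^ k)⁻¹ = p⁻¹ * cs.simple j := by
          generalize p ^ k * t * (p ^ k)⁻¹ = q
          constructor
          · intro h
            rw [hp, mul_inv_rev, cs.inv_simple, cs.inv_simple, ← h]
            simp [mul_assoc]
          · intro h
            rw [h, hp]
            simp [mul_assoc]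
        rw [this, mul_inv_eq_iff_eq_mul, mul_assoc, hjn, ← eq_inv_mul_iff_mul_eq, ← mul_assoc,
          ← mul_assoc, ← mul_inv_rev, ← mul_inv_rev, ← pow_succ', ← pow_add]
        rw [show k + (k + 1) = 2 * k + 1 by ring]
      simp only [h1, h2, add_assoc]

/-- The action of `W` on `W × ZMod 2` that records the parity of inversions. -/
noncomputable def parityAction : W →* Function.End (W × ZMod 2) :=
  cs.lift ⟨cs.parityStep, by
    classical
    intro i j
    funext ⟨t, e⟩
    rw [parityStep_mul_pow]
    -- The summand depends on n only modulo m_ij, so over 2 m_ij terms every value occurs twice and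
    -- cancels mod 2.
    have h : ∀ f : ℕ → ZMod 2, (∀ n, f (M i j + n) = f n) →
        ∑ n ∈ Finset.range (2 * M i j), f n = 0 := by
      intro f hf
      rw [two_mul, Finset.sum_range_add, Finset.sum_congr rfl fun n _ => hf n]
      exact CharTwo.add_self_eq_zero _
    rw [h]
    · simp; rfl
    · intro n
      simp [pow_add]⟩

/-- The parity of the number of occurrences of `t` as a right inversion of `w`. -/
noncomputable def invParity (w t : W) : ZMod 2 := (cs.parityAction w (t, 0)).2

open scoped Classical in
-- The action depends only on the product, so the parity of the number of occurrences of t in the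
-- inversion sequence is the same for all words of a given element.
theorem parityAction_wordProd (ω : List B) (t : W) (e : ZMod 2) :
    cs.parityAction (cs.wordProd ω) (t, e) =
      (cs.wordProd ω * t * (cs.wordProd ω)⁻¹, e + (cs.rightInvSeq ω).count t) := by
  induction ω with
  | nil => simp; rfl
  | cons i ω ih =>
    rw [wordProd_cons, map_mul]
    change cs.parityAction (cs.simple i) (cs.parityAction (cs.wordProd ω) (t, e)) = _
    rw [ih]
    have h : cs.parityAction (cs.simple i) = cs.parityStep i := cs.lift_apply_simple _ i
    have h2 : cs.wordProd ω * t * (cs.wordProd ω)⁻¹ = cs.simple i ↔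
        (cs.wordProd ω)⁻¹ * cs.simple i * cs.wordProd ω = t := by
      rw [mul_inv_eq_iff_eq_mul, ← eq_inv_mul_iff_mul_eq, mul_assoc, eq_comm]
    simp only [h, parityStep, rightInvSeq, List.count_cons, beq_iff_eq, h2]
    simp [mul_assoc, add_assoc]

theorem parityAction_apply (w t : W) (e : ZMod 2) :
    cs.parityAction w (t, e) = (w * t * w⁻¹, e + cs.invParity w t) := by
  classical
  obtain ⟨ω, rfl⟩ := cs.wordProd_surjective w
  simp [invParity, parityAction_wordProd]

theorem invParity_mul (x y t : W) :
    cs.invParity (x * y) t = cs.invParity y t + cs.invParity x (y * t * y⁻¹) := by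
  have : cs.parityAction (x * y) (t, 0) = cs.parityAction x (cs.parityAction y (t, 0)) := by
    rw [map_mul]; rfl
  simp only [parityAction_apply, zero_add, Prod.mk.injEq] at this
  exact this.2

theorem invParity_one (t : W) : cs.invParity 1 t = 0 := by
  rw [invParity, map_one]
  rfl

theorem IsReflection.invParity_self {t : W} (ht : cs.IsReflection t) :
    cs.invParity t t = 1 := by
  classical
  obtain ⟨x, i, rfl⟩ := ht
  have h1 := cs.invParity_mul x x⁻¹ (x * cs.simple i * x⁻¹)
  have h2 : cs.invParity (cs.simple i) (cs.simple i) = 1 := by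
    have := cs.parityAction_wordProd [i] (cs.simple i) 0
    simp only [wordProd_singleton, rightInvSeq_singleton] at this
    simp [invParity, this]
  rw [invParity_mul, invParity_mul]
  simp only [mul_inv_cancel, invParity_one] at h1
  simp only [mul_assoc, inv_inv, inv_mul_cancel_left, mul_inv_cancel, mul_one,
    inv_mul_cancel] at h1 ⊢
  rw [h2]
  -- The contributions of x and x⁻¹ cancel because x x⁻¹ = 1, leaving that of the simple reflection.
  linear_combination (-h1)

theorem mem_rightInvSeq_of_invParity {ω : List B} {t : W}
    (h : cs.invParity (cs.wordProd ω) t ≠ 0) : t ∈ cs.rightInvSeq ω := by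
  classical
  by_contra hn
  exact h (by simp [invParity, parityAction_wordProd, List.count_eq_zero_of_not_mem hn])

theorem IsReflection.isRightInversion_iff {t : W} (ht : cs.IsReflection t) (w : W) :
    cs.IsRightInversion w t ↔ cs.invParity w t = 1 := by
  have key (w : W) (h : cs.invParity w t = 1) : cs.IsRightInversion w t := by
    obtain ⟨ω, hω, rfl⟩ := cs.exists_isReduced w
    exact cs.isRightInversion_of_mem_rightInvSeq hω
      (cs.mem_rightInvSeq_of_invParity (by rw [h]; exact one_ne_zero))
  refine ⟨fun h => ?_, key w⟩
  by_contra hne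
  have h0 : cs.invParity w t = 0 := by
    generalize cs.invParity w t = a at hne
    fin_cases a
    · rfl
    · exact absurd rfl hne
  -- Multiplying by t flips the parity, so parity 0 for w would make t an inversion of w t as well
  -- as of w.
  have h1 := key (w * t) (by
    rw [invParity_mul, ht.invParity_self, mul_inv_cancel_right, h0, add_zero])
  exact (ht.isRightInversion_mul_left_iff.1 h1) h

/-- The cocycle property of inversions. -/
theorem IsReflection.isRightInversion_mul_iff {t : W} (ht : cs.IsReflection t) (x y : W) :
    cs.IsRightInversion (x * y) t ↔
      (cs.IsRightInversion y t ↔ ¬ cs.IsRightInversion x (y * t * y⁻¹)) := by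
  rw [ht.isRightInversion_iff, ht.isRightInversion_iff, (ht.conj y).isRightInversion_iff,
    invParity_mul]
  generalize cs.invParity y t = a
  generalize cs.invParity x (y * t * y⁻¹) = b
  revert a b
  decide

theorem IsReflection.isLeftInversion_mul_iff {t : W} (ht : cs.IsReflection t) (x y : W) :
    cs.IsLeftInversion (x * y) t ↔
      (cs.IsLeftInversion x t ↔ ¬ cs.IsLeftInversion y (x⁻¹ * t * x)) := by
  rw [← isRightInversion_inv_iff, ← isRightInversion_inv_iff, ← isRightInversion_inv_iff,
    mul_inv_rev, ht.isRightInversion_mul_iff, inv_inv]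

/-- The strong exchange property. -/
theorem IsRightInversion.mem_rightInvSeq {ω : List B} {t : W}
    (h : cs.IsRightInversion (cs.wordProd ω) t) : t ∈ cs.rightInvSeq ω :=
  cs.mem_rightInvSeq_of_invParity (by rw [(h.1.isRightInversion_iff cs _).1 h]; exact one_ne_zero)

theorem IsLeftInversion.mem_leftInvSeq {ω : List B} {t : W}
    (h : cs.IsLeftInversion (cs.wordProd ω) t) : t ∈ cs.leftInvSeq ω := by
  rw [← isRightInversion_inv_iff, ← wordProd_reverse] at h
  have := h.mem_rightInvSeq
  rwa [rightInvSeq_reverse, List.mem_reverse] at this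

theorem IsLeftInversion.exists_eraseIdx {ω : List B} {t : W}
    (h : cs.IsLeftInversion (cs.wordProd ω) t) :
    ∃ j < ω.length, t * cs.wordProd ω = cs.wordProd (ω.eraseIdx j) := by
  obtain ⟨j, hj, hjt⟩ := List.mem_iff_getElem.1 h.mem_leftInvSeq
  refine ⟨j, by simpa using hj, ?_⟩
  rw [← getD_leftInvSeq_mul_wordProd, List.getD_eq_getElem _ _ hj, hjt]

end CoxeterSystem

namespace CoxeterAtlas

/-! ### Parabolic subgroups, minimal coset representatives and the twisted length. -/

section Parabolic

variable {B W : Type*} [Group W] {M : CoxeterMatrix B} (cs : CoxeterSystem M W) {J : Set B}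

theorem simple_mem_parabolic {j : B} (hj : j ∈ J) : cs.simple j ∈ parabolic cs J :=
  Subgroup.subset_closure ⟨j, hj, rfl⟩

theorem wordProd_mem_parabolic {ω : List B} (hω : ∀ i ∈ ω, i ∈ J) :
    cs.wordProd ω ∈ parabolic cs J := by
  induction ω with
  | nil => simp
  | cons i ω ih =>
    rw [cs.wordProd_cons]
    exact mul_mem (simple_mem_parabolic cs (hω i (by simp)))
      (ih fun j hj => hω j (List.mem_cons_of_mem _ hj))

theorem exists_wordProd_of_mem_parabolic {x : W} (hx : x ∈ parabolic cs J) :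
    ∃ ω : List B, (∀ i ∈ ω, i ∈ J) ∧ x = cs.wordProd ω := by
  induction hx using Subgroup.closure_induction with
  | mem x hx =>
    obtain ⟨j, hj, rfl⟩ := hx
    exact ⟨[j], by simpa using hj, by simp⟩
  | one => exact ⟨[], by simp, by simp⟩
  | mul x y _ _ hx hy =>
    obtain ⟨ω, hω, rfl⟩ := hx
    obtain ⟨η, hη, rfl⟩ := hy
    refine ⟨ω ++ η, fun i hi => ?_, by rw [cs.wordProd_append]⟩
    rcases List.mem_append.1 hi with h | h
    exacts [hω i h, hη i h]
  | inv x _ hx =>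
    obtain ⟨ω, hω, rfl⟩ := hx
    exact ⟨ω.reverse, fun i hi => hω i (List.mem_reverse.1 hi), by simp⟩

/-- Adding a letter either keeps the word reduced or, by exchange, amounts to deleting one; no
letter outside J ever appears. -/
theorem exists_isReduced_of_mem_parabolic {x : W} (hx : x ∈ parabolic cs J) :
    ∃ ω : List B, cs.IsReduced ω ∧ (∀ i ∈ ω, i ∈ J) ∧ x = cs.wordProd ω := by
  obtain ⟨ω, hω, rfl⟩ := exists_wordProd_of_mem_parabolic cs hx
  clear hx
  induction ω with
  | nil => exact ⟨[], by simp [CoxeterSystem.IsReduced], by simp, rfl⟩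
  | cons i ω ih =>
    obtain ⟨η, hr, hη, h⟩ := ih fun j hj => hω j (List.mem_cons_of_mem _ hj)
    rw [cs.wordProd_cons, h]
    have hi : i ∈ J := hω i (by simp)
    by_cases hd : cs.IsLeftDescent (cs.wordProd η) i
    · obtain ⟨j, hj, hjη⟩ :=
        ((cs.isLeftInversion_simple_iff_isLeftDescent _ _).2 hd).exists_eraseIdx
      refine ⟨η.eraseIdx j, ?_, fun k hk => hη k (List.mem_of_mem_eraseIdx hk), hjη⟩
      have h1 := cs.isLeftDescent_iff.1 hd
      rw [hr.eq, hjη] at h1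
      rw [CoxeterSystem.IsReduced, List.length_eraseIdx_of_lt hj]
      omega
    · refine ⟨i :: η, ?_, ?_, by rw [cs.wordProd_cons]⟩
      · rw [CoxeterSystem.IsReduced, cs.wordProd_cons, cs.not_isLeftDescent_iff.1 hd, hr.eq,
          List.length_cons]
      · simpa [hi] using hη

/-- The inversions of an element of `W_J` are conjugate in `W_J` to simple reflections in `J`. -/
theorem exists_conj_of_isLeftInversion {x t : W} (hx : x ∈ parabolic cs J)
    (ht : cs.IsLeftInversion x t) :
    ∃ y ∈ parabolic cs J, ∃ j ∈ J, t = y * cs.simple j * y⁻¹ := by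
  obtain ⟨ω, hω, rfl⟩ := exists_wordProd_of_mem_parabolic cs hx
  obtain ⟨k, hk, rfl⟩ := List.mem_iff_getElem.1 ht.mem_leftInvSeq
  have hk' : k < ω.length := by simpa using hk
  exact ⟨_, wordProd_mem_parabolic cs fun i hi => hω i (List.mem_of_mem_take hi), ω[k],
    hω _ (List.getElem_mem hk'), cs.getElem_leftInvSeq ω k hk'⟩

theorem mem_parabolic_of_isLeftInversion {x t : W} (hx : x ∈ parabolic cs J)
    (ht : cs.IsLeftInversion x t) : t ∈ parabolic cs J := by
  obtain ⟨y, hy, j, hj, rfl⟩ := exists_conj_of_isLeftInversion cs hx ht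
  exact mul_mem (mul_mem hy (simple_mem_parabolic cs hj)) (inv_mem hy)

theorem mem_parabolic_of_isRightInversion {x t : W} (hx : x ∈ parabolic cs J)
    (ht : cs.IsRightInversion x t) : t ∈ parabolic cs J :=
  mem_parabolic_of_isLeftInversion cs (inv_mem hx) (cs.isLeftInversion_inv_iff.2 ht)

theorem isLeftInversion_self {t : W} (ht : cs.IsReflection t) : cs.IsLeftInversion t t :=
  ⟨ht, by rw [ht.mul_self, cs.length_one]; exact ht.odd_length.pos⟩

/-- `y` has minimal length in the coset `W_J y`. -/
def IsLeftMin (J : Set B) (y : W) : Prop :=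
  ∀ u ∈ parabolic cs J, cs.length y ≤ cs.length (u * y)

theorem inv_mem_minReps_iff {w : W} : w⁻¹ ∈ minReps cs J ↔ IsLeftMin cs J w := by
  constructor
  · intro h u hu
    have := h u⁻¹ (inv_mem hu)
    rwa [← mul_inv_rev, cs.length_inv, cs.length_inv] at this
  · intro h u hu
    have := h u⁻¹ (inv_mem hu)
    rwa [← cs.length_inv (w⁻¹ * u), mul_inv_rev, inv_inv, cs.length_inv]

theorem mem_minReps_iff {w : W} : w ∈ minReps cs J ↔ IsLeftMin cs J w⁻¹ := by
  rw [← inv_mem_minReps_iff, inv_inv]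

theorem exists_eq_mul_isLeftMin (J : Set B) (w : W) :
    ∃ x ∈ parabolic cs J, ∃ y, IsLeftMin cs J y ∧ w = x * y := by
  obtain ⟨⟨u, hu⟩, hmin⟩ := exists_minimalFor_of_wellFoundedLT (fun _ : parabolic cs J => True)
    (fun u => cs.length (u.1 * w)) ⟨1, trivial⟩
  refine ⟨u⁻¹, inv_mem hu, u * w, fun v hv => ?_, by simp⟩
  rcases le_total (cs.length (u * w)) (cs.length (v * (u * w))) with h | h
  · exact h
  · have := hmin.2 (j := ⟨v * u, mul_mem hv hu⟩) trivial (by simpa [mul_assoc] using h)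
    simpa [mul_assoc] using this

variable {cs}

theorem IsLeftMin.not_isLeftInversion {y t : W} (hy : IsLeftMin cs J y)
    (ht : t ∈ parabolic cs J) : ¬ cs.IsLeftInversion y t :=
  fun h => (hy t ht).not_gt h.2

/-- One term of the cocycle identity vanishes: y has no inversion in W_J. In the companion
`isLeftInversion_mul_iff_of_not_mem` it is x that has none outside W_J. -/
theorem IsLeftMin.isLeftInversion_mul_iff {x y t : W} (hy : IsLeftMin cs J y)
    (hx : x ∈ parabolic cs J) (htr : cs.IsReflection t) (ht : t ∈ parabolic cs J) :
    cs.IsLeftInversion (x * y) t ↔ cs.IsLeftInversion x t := by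
  have := hy.not_isLeftInversion (mul_mem (mul_mem (inv_mem hx) ht) hx)
  rw [htr.isLeftInversion_mul_iff]
  tauto

theorem isLeftInversion_mul_iff_of_not_mem {x y t : W}
    (hx : x ∈ parabolic cs J) (htr : cs.IsReflection t) (ht : t ∉ parabolic cs J) :
    cs.IsLeftInversion (x * y) t ↔ cs.IsLeftInversion y (x⁻¹ * t * x) := by
  have h : ¬ cs.IsLeftInversion x t := fun h => ht (mem_parabolic_of_isLeftInversion cs hx h)
  rw [htr.isLeftInversion_mul_iff]
  tauto

theorem IsLeftMin.length_mul {x y : W} (hy : IsLeftMin cs J y) (hx : x ∈ parabolic cs J) :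
    cs.length (x * y) = cs.length x + cs.length y := by
  obtain ⟨ω, hr, hω, rfl⟩ := exists_isReduced_of_mem_parabolic cs hx
  clear hx
  induction ω with
  | nil => simp
  | cons i ω ih =>
    have hω' : ∀ j ∈ ω, j ∈ J := fun j hj => hω j (List.mem_cons_of_mem _ hj)
    have hr' : cs.IsReduced ω := by simpa using hr.drop 1
    have hi := simple_mem_parabolic cs (hω i (by simp))
    have hd : ¬ cs.IsLeftDescent (cs.wordProd ω) i := by
      rw [cs.not_isLeftDescent_iff, ← cs.wordProd_cons, hr.eq, hr'.eq, List.length_cons]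
    have hd' := hd
    rw [← cs.isLeftInversion_simple_iff_isLeftDescent,
      ← hy.isLeftInversion_mul_iff (wordProd_mem_parabolic cs hω') (cs.isReflection_simple i) hi,
      cs.isLeftInversion_simple_iff_isLeftDescent, cs.not_isLeftDescent_iff, ih hr' hω'] at hd'
    rw [cs.wordProd_cons, mul_assoc, hd', cs.not_isLeftDescent_iff.1 hd]
    omega

theorem IsLeftMin.eq_one {x y : W} (hy : IsLeftMin cs J y) (hx : x ∈ parabolic cs J)
    (hxy : IsLeftMin cs J (x * y)) : x = 1 := by
  have h1 := hy.length_mul hx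
  have h2 := hxy _ (inv_mem hx)
  rw [inv_mul_cancel_left] at h2
  exact cs.length_eq_zero_iff.1 (by omega)

theorem isLeftMin_of_forall_not_isLeftDescent {y : W}
    (h : ∀ j ∈ J, ¬ cs.IsLeftDescent y j) : IsLeftMin cs J y := by
  obtain ⟨x, hx, z, hz, rfl⟩ := exists_eq_mul_isLeftMin cs J y
  obtain ⟨ω, hr, hω, rfl⟩ := exists_isReduced_of_mem_parabolic cs hx
  cases ω with
  | nil => simpa using hz
  | cons i ω =>
    exfalso
    apply h i (hω i (by simp))
    rw [CoxeterSystem.IsLeftDescent, hz.length_mul hx, hr.eq, cs.wordProd_cons, mul_assoc,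
      cs.simple_mul_simple_cancel_left]
    have h1 := cs.length_mul_le (cs.wordProd ω) z
    have h2 := cs.length_wordProd_le ω
    rw [List.length_cons]
    omega

variable (cs)

/-- The smallest length of an element of the coset `W_J w`. -/
noncomputable def minLength (J : Set B) (w : W) : ℕ :=
  sInf {n | ∃ u ∈ parabolic cs J, n = cs.length (u * w)}

variable {cs}

theorem IsLeftMin.minLength_mul {x y : W} (hy : IsLeftMin cs J y) (hx : x ∈ parabolic cs J) :
    minLength cs J (x * y) = cs.length y := by
  apply le_antisymm
  · exact Nat.sInf_le ⟨x⁻¹, inv_mem hx, by simp⟩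
  · refine le_csInf ⟨_, x⁻¹, inv_mem hx, rfl⟩ ?_
    rintro n ⟨u, hu, rfl⟩
    rw [← mul_assoc]
    exact hy _ (mul_mem hu hx)

variable (cs) in
/-- The `J`-twisted length. -/
noncomputable def twistedLength (J : Set B) (w : W) : ℤ :=
  2 * minLength cs J w - cs.length w

/-- For x in W_J and y minimal the twisted length of xy is ℓ(y) - ℓ(x). If t is outside W_J, write
(x⁻¹tx)y = x'y'; then ℓ(x') + ℓ(y') < ℓ(y) and ℓ(x) ≤ ℓ(xx') + ℓ(x') give the drop. If t is in W_J,
only the W_J-factor changes and it gets longer. -/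
theorem TwistedStep.twistedLength_lt {a b : W} (h : TwistedStep cs J a b) :
    twistedLength cs J a < twistedLength cs J b := by
  obtain ⟨t, ht, rfl, h⟩ := h
  obtain ⟨x, hx, y, hy, rfl⟩ := exists_eq_mul_isLeftMin cs J b
  rcases h with ⟨htJ, hl⟩ | ⟨htJ, hl⟩
  · have hinv : cs.IsLeftInversion y (x⁻¹ * t * x) :=
      (isLeftInversion_mul_iff_of_not_mem hx ht htJ).1 ⟨ht, hl⟩
    obtain ⟨x', hx', y', hy', h'⟩ := exists_eq_mul_isLeftMin cs J (x⁻¹ * t * x * y)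
    have h1 : t * (x * y) = (x * x') * y' := by
      rw [mul_assoc x, ← h']
      simp [mul_assoc]
    have h2 := hinv.2
    rw [h', hy'.length_mul hx'] at h2
    have h3 := cs.length_le_length_mul_add_right x x'
    rw [h1, twistedLength, twistedLength, hy'.minLength_mul (mul_mem hx hx'), hy.minLength_mul hx,
      hy.length_mul hx, hy'.length_mul (mul_mem hx hx')]
    omega
  · rw [twistedLength, twistedLength, hy.minLength_mul hx, ← mul_assoc,
      hy.minLength_mul (mul_mem htJ hx), mul_assoc]
    omega

theorem TwistedLE.eq_or_twistedLength_lt {a b : W} (h : TwistedLE cs J a b) :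
    a = b ∨ twistedLength cs J a < twistedLength cs J b := by
  induction h with
  | refl => exact Or.inl rfl
  | tail _ hs ih =>
    right
    rcases ih with rfl | ih
    exacts [hs.twistedLength_lt, ih.trans hs.twistedLength_lt]

variable (cs J) in
theorem isPartialOrder_twistedLE : IsPartialOrder W (TwistedLE cs J) where
  refl _ := Relation.ReflTransGen.refl
  trans _ _ _ := Relation.ReflTransGen.trans
  antisymm a b hab hba := by
    rcases hab.eq_or_twistedLength_lt with h | h
    · exact h
    rcases hba.eq_or_twistedLength_lt with h' | h'
    · exact h'.symm
    · exact absurd h h'.not_gt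

end Parabolic

end CoxeterAtlas

namespace CoxeterSystem

/-! ### The geometric representation and the order of s_i s_j. -/

section Order

open Real Module Polynomial.Chebyshev

variable {B : Type*} (M : CoxeterMatrix B)

/-- The simple coroot of the geometric representation, evaluated by `α_j ↦ -2 cos (π / m_ij)`. -/
noncomputable def coroot (i : B) : Dual ℝ (B →₀ ℝ) :=
  Finsupp.linearCombination ℝ fun j => -2 * cos (π / M i j)

theorem coroot_single (i j : B) :
    coroot M i (Finsupp.single j 1) = -2 * cos (π / M i j) := by
  simp [coroot]

theorem coroot_self (i : B) : coroot M i (Finsupp.single i 1) = 2 := by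
  simp [coroot_single]

theorem coroot_mul_coroot (i j : B) :
    coroot M i (Finsupp.single j 1) * coroot M j (Finsupp.single i 1) - 2 =
      2 * cos (2 * π / M i j) := by
  rw [coroot_single, coroot_single, M.symmetric j i, mul_div_assoc, cos_two_mul]
  ring

/-- The simple reflections of the geometric representation. -/
noncomputable def geomReflection (i : B) : (B →₀ ℝ) ≃ₗ[ℝ] (B →₀ ℝ) :=
  reflection (coroot_self M i)

theorem coroot_eq_zero {i j : B} (h : M i j = 2) : coroot M i (Finsupp.single j 1) = 0 := by
  simp [coroot_single, h]

theorem sin_two_pi_div_pos {m : ℕ} (h : 3 ≤ m) : 0 < sin (2 * π / m) := by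
  have hm : (3 : ℝ) ≤ m := by exact_mod_cast h
  apply sin_pos_of_pos_of_lt_pi
  · positivity
  · rw [div_lt_iff₀ (by linarith)]
    nlinarith [pi_pos]

/-- Powers of a product of two reflections are given by Chebyshev polynomials S evaluated at 2cos θ,
θ = 2π/m. Since S_n(2cos θ) sin θ = sin((n+1)θ), the relevant ones vanish: S_{k-1} for m = 2k and
S_k + S_{k-1} for m = 2k+1. The case m = 2 is separate because then sin θ = 0. -/
theorem geomReflection_mul_pow (i j : B) :
    (geomReflection M i * geomReflection M j) ^ M i j = 1 := by
  rcases eq_or_ne i j with rfl | hij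
  · rw [M.diagonal, pow_one]
    ext1 v
    exact involutive_reflection (coroot_self M i) v
  obtain h0 | h1 | h2 | h3 : M i j = 0 ∨ M i j = 1 ∨ M i j = 2 ∨ 3 ≤ M i j := by omega
  · rw [h0, pow_zero]
  · exact absurd h1 (M.off_diagonal i j hij)
  · have h2' : M j i = 2 := by rwa [M.symmetric]
    rw [h2]
    ext1 v
    have := coroot_eq_zero M h2
    have := coroot_eq_zero M h2'
    simp only [pow_two, LinearEquiv.mul_apply, geomReflection, reflection_apply, map_sub, map_smul,
      coroot_self, LinearEquiv.coe_one, id_eq, *]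
    module
  · have hs := sin_two_pi_div_pos h3
    have hS (n : ℤ) := S_two_mul_real_cos (2 * π / M i j) n
    have hmpos : (M i j : ℝ) ≠ 0 := by
      have : M i j ≠ 0 := by omega
      exact_mod_cast this
    apply LinearEquiv.toLinearMap_injective
    rw [geomReflection, geomReflection, reflection_mul_reflection_pow, coroot_mul_coroot]
    obtain ⟨k, hk | hk⟩ := Nat.even_or_odd' (M i j)
    · have e1 : ((M i j : ℤ) - 1) / 2 = k - 1 := by omega
      have e2 : ((M i j : ℤ) - 2) / 2 = k - 1 := by omega
      have : (S ℝ (k - 1)).eval (2 * cos (2 * π / M i j)) = 0 := by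
        have h := hS (k - 1)
        have e : (((k - 1 : ℤ) : ℝ) + 1) * (2 * π / M i j) = π := by
          have : (M i j : ℝ) = 2 * k := by exact_mod_cast hk
          field_simp
          rw [this]
          push_cast
          ring
        rw [e, sin_pi] at h
        exact (mul_eq_zero.1 h).resolve_right hs.ne'
      rw [e1, e2, this]
      simp
    · have e1 : ((M i j : ℤ) - 1) / 2 = k := by omega
      have e2 : ((M i j : ℤ) - 2) / 2 = k - 1 := by omega
      have e3 : ((M i j : ℤ) - 3) / 2 = k - 1 := by omega
      have e4 : (M i j : ℤ) / 2 = k := by omega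
      have : (S ℝ k).eval (2 * cos (2 * π / M i j)) +
          (S ℝ (k - 1)).eval (2 * cos (2 * π / M i j)) = 0 := by
        have h := hS k
        have h' := hS (k - 1)
        have e : ((k : ℤ) + 1 : ℝ) * (2 * π / M i j) =
            2 * π - ((k - 1 : ℤ) + 1 : ℝ) * (2 * π / M i j) := by
          have : (M i j : ℝ) = 2 * k + 1 := by exact_mod_cast hk
          field_simp
          rw [this]
          push_cast
          ring
        rw [e, sin_two_pi_sub] at h
        refine (mul_eq_zero.1 (?_ : _ * sin (2 * π / M i j) = 0)).resolve_right hs.ne'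
        rw [add_mul, h, h']
        ring
      rw [e1, e2, e3, e4, this]
      simp

variable {M} {W : Type*} [Group W] (cs : CoxeterSystem M W)

/-- The geometric representation. -/
noncomputable def geomRep : W →* ((B →₀ ℝ) ≃ₗ[ℝ] (B →₀ ℝ)) :=
  cs.lift ⟨geomReflection M, geomReflection_mul_pow M⟩

theorem geomRep_simple (i : B) : cs.geomRep (cs.simple i) = geomReflection M i :=
  cs.lift_apply_simple _ i

/-- The order of `s_i s_j` is a multiple of `m_ij`. -/
theorem dvd_of_simple_mul_simple_pow_eq_one {i j : B} {p : ℕ}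
    (h : (cs.simple i * cs.simple j) ^ p = 1) : M i j ∣ p := by
  rcases eq_or_ne i j with rfl | hij
  · simp
  replace h := congrArg cs.geomRep h
  rw [map_pow, map_mul, geomRep_simple, geomRep_simple, map_one] at h
  have hx := congrArg (fun e => e (Finsupp.single i (1 : ℝ))) h
  simp only [geomReflection, LinearEquiv.coe_one, id_eq] at hx
  rw [reflection_mul_reflection_pow_apply_self, coroot_mul_coroot] at hx
  -- The image of α_i under (s_i s_j)^p has α_i-coordinate S_p + S_{p-1} and α_j-coordinate a
  -- multiple of S_{p-1}; these must be 1 and 0.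
  have hxi := congrArg (fun v => v i) hx
  have hxj := congrArg (fun v => v j) hx
  simp only [Finsupp.add_apply, Finsupp.smul_apply, Finsupp.single_eq_same, smul_eq_mul,
    Finsupp.single_eq_of_ne hij, Finsupp.single_eq_of_ne hij.symm, mul_one, mul_zero, add_zero,
    zero_add] at hxi hxj
  rw [coroot_single, M.symmetric j i] at hxj
  obtain h0 | h1 | h2 | h3 : M i j = 0 ∨ M i j = 1 ∨ M i j = 2 ∨ 3 ≤ M i j := by omega
  -- Here m = 0 encodes infinite order; division by zero makes both cosines 1, and S_{p-1}(2) = p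
  -- forces p = 0.
  · rw [h0] at hxj ⊢
    simp at hxj
    simp [hxj]
  · simp [h1]
  · rw [h2] at hxi ⊢
    have e : (2 : ℝ) * cos (2 * π / (2 : ℕ)) = -2 := by
      rw [Nat.cast_ofNat, mul_div_cancel_left₀ _ two_ne_zero, cos_pi]
      norm_num
    rw [e] at hxi
    simp only [S_eval_neg_two] at hxi
    obtain hp | hp := Nat.even_or_odd p
    · exact hp.two_dvd
    · have hp' : Odd (p : ℤ) := by exact_mod_cast hp
      have hp'' : Even ((p : ℤ) - 1) := by simpa [parity_simps] using hp'
      rw [Int.negOnePow_odd _ hp', Int.negOnePow_even _ hp''] at hxi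
      push_cast at hxi
      linarith
  · have hs := sin_two_pi_div_pos h3
    have hS := S_two_mul_real_cos (2 * π / M i j) p
    have hS' := S_two_mul_real_cos (2 * π / M i j) (p - 1)
    have hm : (3 : ℝ) ≤ M i j := by exact_mod_cast h3
    have hc : 0 < cos (π / M i j) := by
      apply cos_pos_of_mem_Ioo
      constructor
      · have : 0 < π / M i j := by positivity
        linarith [pi_pos]
      · apply div_lt_div_of_pos_left pi_pos <;> linarith
    have h4 : (S ℝ (p - 1)).eval (2 * cos (2 * π / M i j)) = 0 := by
      apply (mul_eq_zero.1 hxj).resolve_right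
      linarith
    rw [h4, add_zero] at hxi
    rw [hxi, one_mul] at hS
    rw [h4, zero_mul] at hS'
    push_cast at hS hS'
    rw [sub_add_cancel] at hS'
    rw [add_mul, one_mul, sin_add, ← hS', zero_mul, zero_add] at hS
    have h5 : cos (p * (2 * π / M i j)) = 1 := by
      apply mul_right_cancel₀ hs.ne'
      rw [one_mul, ← hS]
    obtain ⟨n, hn⟩ := (cos_eq_one_iff _).1 h5
    have h6 : (p : ℝ) = n * M i j := by
      have := pi_pos
      field_simp at hn
      linarith
    have h7 : (p : ℤ) = M i j * n := by
      rw [mul_comm]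
      exact_mod_cast h6
    exact Int.natCast_dvd_natCast.1 ⟨n, h7⟩

theorem simple_injective : Function.Injective cs.simple := by
  intro i j h
  by_contra hij
  have h1 := cs.dvd_of_simple_mul_simple_pow_eq_one (i := i) (j := j) (p := 1)
    (by rw [h, cs.simple_mul_simple_self, one_pow])
  exact M.off_diagonal i j hij (Nat.dvd_one.1 h1)

end Order

end CoxeterSystem

namespace CoxeterAtlas

/-! ### Alternating words and elements with two left descents. -/

section Dihedral

variable {B W : Type*} [Group W] {M : CoxeterMatrix B} (cs : CoxeterSystem M W)

/-- The word of length `k` that alternates between `i` and `j`, starting with `i`. -/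
def altWord (i j : B) : ℕ → List B
  | 0 => []
  | k + 1 => i :: altWord j i k

theorem length_altWord (i j : B) (k : ℕ) : (altWord i j k).length = k := by
  induction k generalizing i j with
  | zero => rfl
  | succ k ih => simp [altWord, ih]

theorem map_altWord {B' : Type*} (f : B → B') (i j : B) (k : ℕ) :
    (altWord i j k).map f = altWord (f i) (f j) k := by
  induction k generalizing i j with
  | zero => rfl
  | succ k ih => simp [altWord, ih]

theorem altWord_subset (i j : B) (k : ℕ) : ∀ a ∈ altWord i j k, a ∈ ({i, j} : Set B) := by
  induction k generalizing i j with
  | zero => simp [altWord]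
  | succ k ih =>
    intro a ha
    rcases List.mem_cons.1 ha with rfl | h
    · simp
    · rw [Set.pair_comm]
      exact ih j i a h

theorem altWord_succ' (i j : B) (k : ℕ) :
    altWord i j (k + 1) = altWord i j k ++ [if Even k then i else j] := by
  induction k generalizing i j with
  | zero => simp [altWord]
  | succ k ih =>
    rw [altWord, ih j i, altWord, List.cons_append]
    by_cases h : Even k <;> simp [h, Nat.even_add_one, -Nat.not_even_iff_odd]

theorem altWord_eq_reverse (i j : B) (k : ℕ) :
    altWord j i k = (CoxeterSystem.alternatingWord i j k).reverse := by
  induction k generalizing i j with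
  | zero => rfl
  | succ k ih => simp [altWord, CoxeterSystem.alternatingWord_succ, ih j i]

theorem wordProd_altWord_comm (i j : B) :
    cs.wordProd (altWord i j (M i j)) = cs.wordProd (altWord j i (M i j)) := by
  rw [altWord_eq_reverse, altWord_eq_reverse, cs.wordProd_reverse, cs.wordProd_reverse, inv_inj]
  have := cs.wordProd_braidWord_eq i j
  rw [CoxeterSystem.braidWord, CoxeterSystem.braidWord, ← M.symmetric i j] at this
  exact this.symm

theorem exists_of_mem_leftInvSeq_altWord {i j : B} {k : ℕ} {t : W}
    (ht : t ∈ cs.leftInvSeq (altWord i j k)) :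
    ∃ q < k, t = (cs.simple i * cs.simple j) ^ q * cs.simple i := by
  induction k generalizing i j t with
  | zero => simp [altWord] at ht
  | succ k ih =>
    rw [altWord, CoxeterSystem.leftInvSeq] at ht
    rcases List.mem_cons.1 ht with rfl | ht
    · exact ⟨0, by omega, by simp⟩
    · obtain ⟨t', ht', rfl⟩ := List.mem_map.1 ht
      obtain ⟨q, hq, rfl⟩ := ih ht'
      refine ⟨q + 1, by omega, ?_⟩
      have h : SemiconjBy (cs.simple i) (cs.simple j * cs.simple i)
          (cs.simple i * cs.simple j) := by simp [SemiconjBy, mul_assoc]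
      rw [MulAut.conj_apply, cs.inv_simple, ← mul_assoc, (h.pow_right q).eq, pow_succ]
      simp [mul_assoc]

/-- If the remainder y did not start with the next letter, it would be minimal for {i, j}; then s_j
would be an inversion of the alternating prefix, which is too short for that. -/
theorem exists_eq_altWord_mul {i j : B} {w : W} (hi : cs.IsLeftDescent w i)
    (hj : cs.IsLeftDescent w j) (k : ℕ) (hk : M i j = 0 ∨ k ≤ M i j) :
    ∃ y, w = cs.wordProd (altWord i j k) * y ∧ cs.length w = k + cs.length y := by
  induction k with
  | zero => exact ⟨w, by simp [altWord], by simp⟩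
  | succ k ih =>
    obtain ⟨y, hw, hl⟩ := ih (by omega)
    suffices h : cs.IsLeftDescent y (if Even k then i else j) by
      refine ⟨cs.simple (if Even k then i else j) * y, ?_, ?_⟩
      · rw [altWord_succ', cs.wordProd_append, cs.wordProd_singleton, mul_assoc,
          cs.simple_mul_simple_cancel_left, hw]
      · have := cs.isLeftDescent_iff.1 h
        omega
    cases k with
    | zero =>
      rw [altWord, cs.wordProd_nil, one_mul] at hw
      simpa [← hw] using hi
    | succ k =>
      by_contra h
      -- The last letter of the prefix is no descent of y either: it would cancel and make w too
      -- short.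
      have h' : ¬ cs.IsLeftDescent y (if Even k then i else j) := by
        intro hd
        have h1 := cs.isLeftDescent_iff.1 hd
        have h2 := cs.length_mul_le (cs.wordProd (altWord i j k))
          (cs.simple (if Even k then i else j) * y)
        rw [← mul_assoc, ← cs.wordProd_singleton, ← cs.wordProd_append, ← altWord_succ', ← hw,
          cs.wordProd_singleton] at h2
        have h3 := cs.length_wordProd_le (altWord i j k)
        rw [length_altWord] at h3
        omega
      have hmin : IsLeftMin cs {i, j} y := by
        apply isLeftMin_of_forall_not_isLeftDescent
        by_cases he : Even k <;>
          simp only [Nat.even_add_one, he, not_true_eq_false, not_false_eq_true, if_true,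
            if_false] at h h' <;>
          rintro a (rfl | rfl) <;> assumption
      have hj' := (cs.isLeftInversion_simple_iff_isLeftDescent _ _).2 hj
      rw [hw, hmin.isLeftInversion_mul_iff (wordProd_mem_parabolic cs (altWord_subset i j _))
        (cs.isReflection_simple j) (simple_mem_parabolic cs (by simp))] at hj'
      obtain ⟨q, hq, h⟩ := exists_of_mem_leftInvSeq_altWord cs hj'.mem_leftInvSeq
      -- From s_j = (s_i s_j)^q s_i; but 0 < q + 1 < m_ij unless the order is infinite,
      -- contradicting divisibility.
      have : (cs.simple i * cs.simple j) ^ (q + 1) = 1 := by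
        rw [pow_succ, ← mul_assoc, ← h, cs.simple_mul_simple_self]
      have := cs.dvd_of_simple_mul_simple_pow_eq_one this
      rcases hk with hk | hk
      · rw [hk] at this
        simp at this
      · have := Nat.le_of_dvd (by omega) this
        omega

theorem matrix_ne_zero_of_isLeftDescent {i j : B} {w : W} (hi : cs.IsLeftDescent w i)
    (hj : cs.IsLeftDescent w j) : M i j ≠ 0 := by
  intro h
  obtain ⟨y, -, hl⟩ := exists_eq_altWord_mul cs hi hj (cs.length w + 1) (Or.inl h)
  omega

theorem isLeftDescent_of_isReduced_cons {i : B} {ω : List B} (h : cs.IsReduced (i :: ω)) :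
    cs.IsLeftDescent (cs.wordProd (i :: ω)) i := by
  rw [CoxeterSystem.IsLeftDescent, h.eq, cs.wordProd_cons, cs.simple_mul_simple_cancel_left]
  exact (cs.length_wordProd_le ω).trans_lt (by simp)

/-- The intersection of two standard parabolic subgroups. -/
theorem mem_parabolic_inter {J J' : Set B} {x : W} (hx : x ∈ parabolic cs J)
    (hx' : x ∈ parabolic cs J') : x ∈ parabolic cs (J ∩ J') := by
  have key : ∀ i : B, cs.simple i ∈ parabolic cs J' → i ∈ J' := by
    intro i hi
    obtain ⟨ω, hr, hω, h⟩ := exists_isReduced_of_mem_parabolic cs hi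
    have hl := hr.eq
    rw [← h, cs.length_simple] at hl
    obtain ⟨j, rfl⟩ := List.length_eq_one_iff.1 hl.symm
    rw [cs.wordProd_singleton] at h
    rw [cs.simple_injective h]
    exact hω j (by simp)
  obtain ⟨ω, hr, hω, rfl⟩ := exists_isReduced_of_mem_parabolic cs hx
  clear hx
  apply wordProd_mem_parabolic
  induction ω with
  | nil => simp
  | cons i ω ih =>
    -- The first letter is a left inversion of an element of W_{J'}, hence lies in W_{J'}, and can
    -- be stripped off.
    have hd := (cs.isLeftInversion_simple_iff_isLeftDescent _ _).2
      (isLeftDescent_of_isReduced_cons cs hr)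
    have hs := mem_parabolic_of_isLeftInversion cs hx' hd
    have hi := key i hs
    rw [cs.wordProd_cons] at hx'
    have := ih (by simpa using hr.drop 1) (fun j hj => hω j (List.mem_cons_of_mem _ hj))
      (by simpa using mul_mem hs hx')
    intro j hj
    rcases List.mem_cons.1 hj with rfl | hj
    · exact ⟨hω j (by simp), hi⟩
    · exact this j hj

end Dihedral

/-! ### Embeddings of Coxeter matrices preserve length. -/

section Embedding

variable {B W : Type*} [Group W] {M : CoxeterMatrix B} (cs : CoxeterSystem M W)
  {B' W' : Type*} [Group W'] {M' : CoxeterMatrix B'} (cs' : CoxeterSystem M' W')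
  {f : B → B'} {φ : W →* W'}

variable {cs cs'} in
theorem map_wordProd (hφ : ∀ i, φ (cs.simple i) = cs'.simple (f i)) (ω : List B) :
    φ (cs.wordProd ω) = cs'.wordProd (ω.map f) := by
  induction ω with
  | nil => simp
  | cons i ω ih => rw [cs.wordProd_cons, map_mul, ih, hφ, List.map_cons, cs'.wordProd_cons]

variable {cs cs'} in
theorem map_mem_parabolic_range (hφ : ∀ i, φ (cs.simple i) = cs'.simple (f i)) (w : W) :
    φ w ∈ parabolic cs' (Set.range f) := by
  obtain ⟨ω, rfl⟩ := cs.wordProd_surjective w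
  rw [map_wordProd hφ]
  apply wordProd_mem_parabolic
  intro i hi
  obtain ⟨j, hj, rfl⟩ := List.mem_map.1 hi
  exact ⟨j, rfl⟩

theorem exists_map_eq_of_subset_image {K : Set B} {ω : List B'} (hω : ∀ i ∈ ω, i ∈ f '' K) :
    ∃ γ : List B, (∀ i ∈ γ, i ∈ K) ∧ γ.map f = ω := by
  induction ω with
  | nil => exact ⟨[], by simp, rfl⟩
  | cons i ω ih =>
    obtain ⟨γ, hγ, rfl⟩ := ih fun j hj => hω j (List.mem_cons_of_mem _ hj)
    obtain ⟨j, hj, rfl⟩ := hω i (by simp)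
    exact ⟨j :: γ, by simpa [hj] using hγ, rfl⟩

variable {cs cs'} in
theorem exists_map_eq_of_mem_parabolic_image (hφ : ∀ i, φ (cs.simple i) = cs'.simple (f i))
    {K : Set B} {x : W'} (hx : x ∈ parabolic cs' (f '' K)) : ∃ w ∈ parabolic cs K, φ w = x := by
  obtain ⟨ω, hω, rfl⟩ := exists_wordProd_of_mem_parabolic cs' hx
  obtain ⟨γ, hγ, rfl⟩ := exists_map_eq_of_subset_image hω
  exact ⟨cs.wordProd γ, wordProd_mem_parabolic cs hγ, map_wordProd hφ γ⟩

/-- An element of `W_{f(B)}` has a reduced word with letters in the image of `f`. -/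
theorem exists_isReduced_map {x : W'} (hx : x ∈ parabolic cs' (Set.range f)) :
    ∃ γ : List B, cs'.IsReduced (γ.map f) ∧ x = cs'.wordProd (γ.map f) := by
  obtain ⟨ω, hr, hω, rfl⟩ := exists_isReduced_of_mem_parabolic cs' hx
  obtain ⟨γ, -, rfl⟩ := exists_map_eq_of_subset_image (K := Set.univ) (by simpa using hω)
  exact ⟨γ, hr, rfl⟩

/-- Two words in the image of `f` that are reduced with the same product already have the same
product in `W`. -/
theorem wordProd_eq_of_isReduced_map (hM : ∀ i j, M' (f i) (f j) = M i j)
    (hφ : ∀ i, φ (cs.simple i) = cs'.simple (f i)) {α β : List B}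
    (hα : cs'.IsReduced (α.map f)) (hβ : cs'.IsReduced (β.map f))
    (h : cs'.wordProd (α.map f) = cs'.wordProd (β.map f)) : cs.wordProd α = cs.wordProd β := by
  induction hn : α.length generalizing α β with
  | zero =>
    have hl : β.length = 0 := by
      have := hβ.eq
      rwa [← h, hα.eq, List.length_map, List.length_map, hn, eq_comm] at this
    rw [List.length_eq_zero_iff.1 hn, List.length_eq_zero_iff.1 hl]
  | succ n ih =>
    have hl : β.length = n + 1 := by
      have := hβ.eq
      rwa [← h, hα.eq, List.length_map, List.length_map, hn, eq_comm] at this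
    have cancel : ∀ (k : B) (γ δ : List B), cs'.IsReduced ((k :: γ).map f) →
        cs'.IsReduced ((k :: δ).map f) → γ.length = n →
        cs'.wordProd ((k :: γ).map f) = cs'.wordProd ((k :: δ).map f) →
        cs.wordProd (k :: γ) = cs.wordProd (k :: δ) := by
      intro k γ δ hγ hδ hγn hh
      rw [cs.wordProd_cons, cs.wordProd_cons]
      congr 1
      refine ih (by simpa using hγ.drop 1) (by simpa using hδ.drop 1) ?_ hγn
      simpa [cs'.wordProd_cons] using hh
    obtain ⟨i, α, rfl⟩ := List.exists_cons_of_length_eq_add_one hn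
    obtain ⟨j, β, rfl⟩ := List.exists_cons_of_length_eq_add_one hl
    by_cases hij : i = j
    · subst hij
      exact cancel i α β hα hβ (by simpa using hn) h
    -- Different first letters: the common product begins with both alternating words of length
    -- m_ij. These already agree in W by the braid relation, so each given word is compared with an
    -- intermediate one sharing its first letter.
    have hi := isLeftDescent_of_isReduced_cons cs' (i := f i) (ω := α.map f) (by simpa using hα)
    have hj := isLeftDescent_of_isReduced_cons cs' (i := f j) (ω := β.map f) (by simpa using hβ)
    rw [← List.map_cons] at hi hj
    rw [← h] at hj
    have hm := matrix_ne_zero_of_isLeftDescent cs' hi hj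
    obtain ⟨y, hy, hly⟩ := exists_eq_altWord_mul cs' hi hj _ (Or.inr le_rfl)
    rw [hM] at hm hy hly
    rw [← map_altWord] at hy
    have hyp : y ∈ parabolic cs' (Set.range f) := by
      rw [← map_wordProd hφ, ← map_wordProd hφ, ← inv_mul_eq_iff_eq_mul, ← map_inv,
        ← map_mul] at hy
      rw [← hy]
      exact map_mem_parabolic_range hφ _
    obtain ⟨γ, hγ, rfl⟩ := exists_isReduced_map cs' hyp
    obtain ⟨m, hm'⟩ := Nat.exists_eq_succ_of_ne_zero hm
    have e1 : cs'.wordProd ((i :: α).map f) =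
        cs'.wordProd ((altWord i j (M i j) ++ γ).map f) := by
      rw [hy, List.map_append, cs'.wordProd_append]
    have e2 : cs'.wordProd ((altWord i j (M i j) ++ γ).map f) =
        cs'.wordProd ((altWord j i (M i j) ++ γ).map f) := by
      rw [List.map_append, List.map_append, cs'.wordProd_append, cs'.wordProd_append, map_altWord,
        map_altWord, ← hM, wordProd_altWord_comm]
    have r1 : cs'.IsReduced ((altWord i j (M i j) ++ γ).map f) := by
      rw [CoxeterSystem.IsReduced, ← e1, hly, hγ.eq]
      simp [length_altWord]
    have r2 : cs'.IsReduced ((altWord j i (M i j) ++ γ).map f) := by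
      rw [CoxeterSystem.IsReduced, ← e2, r1.eq]
      simp [length_altWord]
    have s1 : cs.wordProd (i :: α) = cs.wordProd (altWord i j (M i j) ++ γ) := by
      rw [hm'] at e1 r1 ⊢
      exact cancel i α _ hα r1 (by simpa using hn) e1
    have s2 : cs.wordProd (j :: β) = cs.wordProd (altWord j i (M i j) ++ γ) := by
      rw [h, e2] at e1
      rw [hm'] at e1 r2 ⊢
      exact cancel j β _ hβ r2 (by simpa using hl) e1
    rw [s1, s2, cs.wordProd_append, cs.wordProd_append, wordProd_altWord_comm]

/-- The homomorphism induced by an embedding of Coxeter matrices preserves lengths. -/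
theorem length_map (hM : ∀ i j, M' (f i) (f j) = M i j)
    (hφ : ∀ i, φ (cs.simple i) = cs'.simple (f i)) (w : W) :
    cs'.length (φ w) = cs.length w := by
  -- This extends the comparison of reduced words to an arbitrary first word. If prepending f i
  -- shortens the image, the reduced word δ is traded for one beginning with i, and the two letters
  -- i cancel in W too.
  have key : ∀ ω γ : List B, cs'.IsReduced (γ.map f) →
      cs'.wordProd (ω.map f) = cs'.wordProd (γ.map f) → cs.wordProd ω = cs.wordProd γ := by
    intro ω
    induction ω with
    | nil =>
      intro γ hγ h
      have := hγ.eq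
      rw [← h] at this
      have h0 : γ = [] := List.length_eq_zero_iff.1 (by simpa using this.symm)
      rw [h0]
    | cons i ω ih =>
      intro γ hγ h
      have hex (ω : List B) := exists_isReduced_map cs' (map_mem_parabolic_range hφ
        (cs.wordProd ω))
      obtain ⟨δ, hδ, hωδ⟩ := hex ω
      rw [map_wordProd hφ] at hωδ
      have hω := ih δ hδ hωδ
      rw [List.map_cons, cs'.wordProd_cons, hωδ] at h
      by_cases hd : cs'.IsLeftDescent (cs'.wordProd (δ.map f)) (f i)
      · obtain ⟨ε, hε, hωε⟩ := hex (i :: ω)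
        rw [map_wordProd hφ, List.map_cons, cs'.wordProd_cons, hωδ] at hωε
        have hd' := cs'.isLeftDescent_iff.1 hd
        have e : cs'.wordProd (δ.map f) = cs'.wordProd ((i :: ε).map f) := by
          rw [List.map_cons, cs'.wordProd_cons, ← hωε, cs'.simple_mul_simple_cancel_left]
        have hr : cs'.IsReduced ((i :: ε).map f) := by
          rw [CoxeterSystem.IsReduced, ← e, ← hd', hωε, hε.eq]
          simp
        rw [cs.wordProd_cons, hω, wordProd_eq_of_isReduced_map cs cs' hM hφ hδ hr e,
          cs.wordProd_cons, cs.simple_mul_simple_cancel_left]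
        exact wordProd_eq_of_isReduced_map cs cs' hM hφ hε hγ (by rw [← hωε, h])
      · have hr : cs'.IsReduced ((i :: δ).map f) := by
          rw [CoxeterSystem.IsReduced, List.map_cons, cs'.wordProd_cons,
            cs'.not_isLeftDescent_iff.1 hd, hδ.eq]
          simp
        rw [cs.wordProd_cons, hω, ← cs.wordProd_cons]
        exact wordProd_eq_of_isReduced_map cs cs' hM hφ hr hγ (by
          rw [List.map_cons, cs'.wordProd_cons, h])
  apply le_antisymm
  · obtain ⟨ω, hω, rfl⟩ := cs.exists_isReduced w
    rw [map_wordProd hφ, hω.eq, ← List.length_map (as := ω) f]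
    exact cs'.length_wordProd_le _
  · obtain ⟨ω, rfl⟩ := cs.wordProd_surjective w
    obtain ⟨γ, hγ, h⟩ := exists_isReduced_map cs' (map_mem_parabolic_range hφ (cs.wordProd ω))
    rw [h, hγ.eq, key ω γ hγ (by rw [← h, map_wordProd hφ]), List.length_map]
    exact cs.length_wordProd_le γ

theorem map_injective (hM : ∀ i j, M' (f i) (f j) = M i j)
    (hφ : ∀ i, φ (cs.simple i) = cs'.simple (f i)) : Function.Injective φ := by
  rw [injective_iff_map_eq_one]
  intro w hw
  rw [← cs.length_eq_zero_iff, ← length_map cs cs' hM hφ, hw, cs'.length_one]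

/-- A reflection in `W_{f(B)}` is the image of a reflection. -/
theorem exists_isReflection_of_mem_parabolic_range
    (hφ : ∀ i, φ (cs.simple i) = cs'.simple (f i)) {t : W'} (ht : cs'.IsReflection t)
    (htf : t ∈ parabolic cs' (Set.range f)) : ∃ τ, cs.IsReflection τ ∧ φ τ = t := by
  obtain ⟨y, hy, j, ⟨i, rfl⟩, rfl⟩ :=
    exists_conj_of_isLeftInversion cs' htf (isLeftInversion_self cs' ht)
  rw [← Set.image_univ] at hy
  obtain ⟨w, -, rfl⟩ := exists_map_eq_of_mem_parabolic_image hφ hy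
  exact ⟨w * cs.simple i * w⁻¹, ⟨w, i, rfl⟩, by simp [hφ]⟩

variable {cs cs'} in
theorem isReflection_map (hφ : ∀ i, φ (cs.simple i) = cs'.simple (f i)) {t : W}
    (ht : cs.IsReflection t) : cs'.IsReflection (φ t) := by
  obtain ⟨w, i, rfl⟩ := ht
  exact ⟨φ w, f i, by simp [hφ]⟩

end Embedding

end CoxeterAtlas

namespace CoxeterAtlas

/-! ### Lifting properties of the Bruhat order and transitivity of `PairLE`. -/

section Bruhat

variable {B W : Type*} [Group W] {M : CoxeterMatrix B} (cs : CoxeterSystem M W)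

/-- The relation generated by `b t < b` for right inversions `t` of `b` that satisfy `P`. -/
def RightLE (P : W → Prop) : W → W → Prop :=
  Relation.ReflTransGen fun a b => ∃ t, P t ∧ cs.IsRightInversion b t ∧ a = b * t

variable {cs} {P : W → Prop} {K : Set B} {a b : W}

/-- Left multiplication by s_i keeps the direction of the step bt < b unless s_i = btb⁻¹. The
reflection on the right is unchanged, so P survives; this is the reason for the right-handed form.
-/
theorem simple_mul_rightLE_or {t : W} (i : B) (hP : P t) (ht : cs.IsRightInversion b t) :
    RightLE cs P (cs.simple i * (b * t)) (cs.simple i * b) ∨ cs.simple i * (b * t) = b := by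
  by_cases h : cs.IsRightInversion (cs.simple i) (b * t * b⁻¹)
  · right
    rw [← cs.wordProd_singleton] at h
    have := h.mem_rightInvSeq
    rw [cs.rightInvSeq_singleton, List.mem_singleton, mul_inv_eq_iff_eq_mul] at this
    rw [this, cs.simple_mul_simple_cancel_left]
  · left
    refine Relation.ReflTransGen.single ⟨t, hP, ?_, by rw [mul_assoc]⟩
    rw [ht.1.isRightInversion_mul_iff]
    tauto

theorem RightLE.simple_mul_left (h : RightLE cs P a b) (i : B) :
    RightLE cs P (cs.simple i * a) (cs.simple i * b) ∨ RightLE cs P (cs.simple i * a) b := by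
  induction h with
  | refl => exact Or.inl Relation.ReflTransGen.refl
  | @tail c b _ hs ih =>
    obtain ⟨t, hP, ht, rfl⟩ := hs
    rcases ih with ih | ih
    · rcases simple_mul_rightLE_or i hP ht with h | h
      · exact Or.inl (ih.trans h)
      · rw [h] at ih
        exact Or.inr ih
    · exact Or.inr (ih.tail ⟨t, hP, ht, rfl⟩)

theorem RightLE.simple_mul_right (h : RightLE cs P a b) (i : B) :
    RightLE cs P (cs.simple i * a) (cs.simple i * b) ∨ RightLE cs P a (cs.simple i * b) := by
  induction h with
  | refl => exact Or.inl Relation.ReflTransGen.refl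
  | @tail c b hac hs ih =>
    obtain ⟨t, hP, ht, rfl⟩ := hs
    rcases simple_mul_rightLE_or i hP ht with h | h
    · exact ih.imp (·.trans h) (·.trans h)
    · right
      rwa [← h, cs.simple_mul_simple_cancel_left]

theorem RightLE.bruhatLE (h : RightLE cs P a b) : BruhatLE cs a b := by
  refine Relation.ReflTransGen.mono ?_ _ _ h
  rintro a b ⟨t, -, ht, rfl⟩
  exact ⟨b * t * b⁻¹, ht.1.conj b, by simp, by simpa using ht.2⟩

theorem bruhatLE_iff_rightLE : BruhatLE cs a b ↔ RightLE cs (fun _ => True) a b := by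
  refine ⟨fun h => Relation.ReflTransGen.mono ?_ _ _ h, RightLE.bruhatLE⟩
  rintro a b ⟨t, ht, rfl, hl⟩
  refine ⟨b⁻¹ * t * b, trivial, ⟨by simpa using ht.conj b⁻¹, ?_⟩, by simp [mul_assoc]⟩
  simpa [mul_assoc] using hl

theorem BruhatLE.refl (a : W) : BruhatLE cs a a := Relation.ReflTransGen.refl

theorem BruhatLE.trans {c : W} (h : BruhatLE cs a b) (h' : BruhatLE cs b c) : BruhatLE cs a c :=
  Relation.ReflTransGen.trans h h'

theorem BruhatLE.inv (h : BruhatLE cs a b) : BruhatLE cs a⁻¹ b⁻¹ := by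
  rw [bruhatLE_iff_rightLE]
  induction h with
  | refl => exact Relation.ReflTransGen.refl
  | @tail c b _ hs ih =>
    obtain ⟨t, ht, rfl, hl⟩ := hs
    exact ih.tail ⟨t, trivial, cs.isRightInversion_inv_iff.2 ⟨ht, hl⟩, by rw [mul_inv_rev, ht.inv]⟩

theorem BruhatLE.mul_simple_left (h : BruhatLE cs a b) (i : B) :
    BruhatLE cs (a * cs.simple i) (b * cs.simple i) ∨ BruhatLE cs (a * cs.simple i) b :=
  ((bruhatLE_iff_rightLE.1 h.inv).simple_mul_left i).imp
    (fun h => by simpa using h.bruhatLE.inv) (fun h => by simpa using h.bruhatLE.inv)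

theorem BruhatLE.mul_simple_right (h : BruhatLE cs a b) (i : B) :
    BruhatLE cs (a * cs.simple i) (b * cs.simple i) ∨ BruhatLE cs a (b * cs.simple i) :=
  ((bruhatLE_iff_rightLE.1 h.inv).simple_mul_right i).imp
    (fun h => by simpa using h.bruhatLE.inv) (fun h => by simpa using h.bruhatLE.inv)

theorem BruhatLE.eq_one (h : BruhatLE cs a 1) : a = 1 := by
  rcases Relation.ReflTransGen.cases_tail h with h | ⟨c, -, t, -, -, hl⟩
  · exact h.symm
  · simp at hl

theorem not_mem_parabolic_of_isRightInversion {w t : W} (hw : w ∈ minReps cs K)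
    (ht : cs.IsRightInversion w t) : t ∉ parabolic cs K :=
  fun h => (hw t h).not_gt ht.2

theorem simple_mul_mem_minReps {w : W} {i : B} (hw : w ∈ minReps cs K)
    (hi : cs.IsLeftDescent w i) : cs.simple i * w ∈ minReps cs K := by
  intro u hu
  have h1 := hw u hu
  have h2 := cs.isLeftDescent_iff.1 hi
  rw [mul_assoc]
  rcases cs.length_simple_mul (w * u) i with h | h <;> omega

/-- An element below `w ∈ W^K` in the Bruhat order is joined to `w` by a chain that uses only
right multiplications by reflections outside `W_K`. -/
theorem BruhatLE.rightLE {z w : W} (h : BruhatLE cs z w) (hw : w ∈ minReps cs K) :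
    RightLE cs (· ∉ parabolic cs K) z w := by
  induction hn : cs.length w generalizing z w with
  | zero =>
    rw [cs.length_eq_zero_iff] at hn
    subst hn
    rw [h.eq_one]
    exact Relation.ReflTransGen.refl
  | succ n ih =>
    obtain ⟨i, hi⟩ := cs.exists_leftDescent_of_ne_one (w := w) (by rintro rfl; simp at hn)
    have hl : cs.length (cs.simple i * w) = n := by
      have := cs.isLeftDescent_iff.1 hi
      omega
    have hmin := simple_mul_mem_minReps hw hi
    have hinv : cs.IsRightInversion w (w⁻¹ * cs.simple i * w) :=
      ⟨by simpa using (cs.isReflection_simple i).conj w⁻¹, by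
        simpa [mul_assoc] using (show cs.length _ < cs.length _ from hi)⟩
    have hstep : RightLE cs (· ∉ parabolic cs K) (cs.simple i * w) w :=
      Relation.ReflTransGen.single
        ⟨_, not_mem_parabolic_of_isRightInversion hw hinv, hinv, by simp [mul_assoc]⟩
    rcases (bruhatLE_iff_rightLE.1 h).simple_mul_right i with h | h
    · have := (ih h.bruhatLE hmin hl).simple_mul_left i
      simp only [cs.simple_mul_simple_cancel_left] at this
      exact this.elim id (·.trans hstep)
    · exact (ih h.bruhatLE hmin hl).trans hstep

/-- Along the chain from `BruhatLE.rightLE` every t is outside W_K, so u⁻¹tu is not an inversion of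
u, and the cocycle property keeps each step's direction. -/
theorem BruhatLE.mul_parabolic {z w u : W} (h : BruhatLE cs z w) (hw : w ∈ minReps cs K)
    (hu : u ∈ parabolic cs K) : BruhatLE cs (z * u) (w * u) := by
  have h' := h.rightLE hw
  clear h hw
  rw [bruhatLE_iff_rightLE]
  induction h' with
  | refl => exact Relation.ReflTransGen.refl
  | @tail c b _ hs ih =>
    obtain ⟨t, htK, ht, rfl⟩ := hs
    have hr : cs.IsReflection (u⁻¹ * t * u) := by simpa using ht.1.conj u⁻¹
    refine ih.tail ⟨u⁻¹ * t * u, trivial, ?_, by simp [mul_assoc]⟩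
    have hn : ¬ cs.IsRightInversion u (u⁻¹ * t * u) := by
      intro h
      have := mem_parabolic_of_isRightInversion cs hu h
      apply htK
      simpa [mul_assoc] using mul_mem (mul_mem hu this) (inv_mem hu)
    rw [hr.isRightInversion_mul_iff, show u * (u⁻¹ * t * u) * u⁻¹ = t by simp [mul_assoc]]
    tauto

theorem bruhatLE_mul_simple {w u : W} {i : B} (hw : w ∈ minReps cs K) (hu : u ∈ parabolic cs K)
    (hi : i ∈ K) (hd : ¬ cs.IsRightDescent u i) :
    BruhatLE cs (w * u) (w * (u * cs.simple i)) := by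
  have hr := cs.isReflection_simple i
  have h1 : ¬ cs.IsRightInversion w (u * cs.simple i * u⁻¹) := fun h =>
    not_mem_parabolic_of_isRightInversion hw h
      (mul_mem (mul_mem hu (simple_mem_parabolic cs hi)) (inv_mem hu))
  have h2 : ¬ cs.IsRightInversion (w * u) (cs.simple i) := by
    rw [← cs.isRightInversion_simple_iff_isRightDescent] at hd
    rw [hr.isRightInversion_mul_iff]
    tauto
  rw [bruhatLE_iff_rightLE]
  refine Relation.ReflTransGen.single ⟨cs.simple i, trivial, ?_, ?_⟩
  · rw [← mul_assoc]
    by_contra h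
    exact h2 ((hr.isRightInversion_mul_left_iff.not_left).1 h)
  · simp [mul_assoc]

variable (cs K) in
/-- `u` lies below `u'` after left multiplication by any element of `W^K`. -/
def StablyLE (u u' : W) : Prop :=
  ∀ w ∈ minReps cs K, BruhatLE cs (w * u) (w * u')

/-- Induction on elements of `W_K` by right multiplication with non-descents. -/
theorem parabolic_induction {p : (u : W) → u ∈ parabolic cs K → Prop} (one : p 1 (one_mem _))
    (mul_simple : ∀ u i (hu : u ∈ parabolic cs K) (hi : i ∈ K), ¬ cs.IsRightDescent u i → p u hu →
      p (u * cs.simple i) (mul_mem hu (simple_mem_parabolic cs hi)))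
    {u : W} (hu : u ∈ parabolic cs K) : p u hu := by
  obtain ⟨ω, hr, hω, rfl⟩ := exists_isReduced_of_mem_parabolic cs hu
  induction ω using List.reverseRecOn with
  | nil => simpa using one
  | append_singleton ω i ih =>
    have hr' : cs.IsReduced ω := by simpa using hr.take ω.length
    have hω' : ∀ j ∈ ω, j ∈ K := fun j hj => hω j (List.mem_append_left _ hj)
    have e : cs.wordProd (ω ++ [i]) = cs.wordProd ω * cs.simple i := by
      rw [cs.wordProd_append, cs.wordProd_singleton]
    have hd : ¬ cs.IsRightDescent (cs.wordProd ω) i := by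
      rw [cs.not_isRightDescent_iff, ← e, hr.eq, hr'.eq, List.length_append, List.length_singleton]
    have := mul_simple _ i _ (hω i (by simp)) hd (ih hr' hω' (wordProd_mem_parabolic cs hω'))
    simpa only [e] using this

/-- Letters of u are lifted across the inequality one at a time and u' keeps only some of them. This
and the next lemma let elements of W_K be moved between the two sides of an inequality. -/
theorem BruhatLE.exists_mul_le {a c u : W} (h : BruhatLE cs a c) (hu : u ∈ parabolic cs K) :
    ∃ u' ∈ parabolic cs K, BruhatLE cs (a * u) (c * u') ∧ StablyLE cs K u' u := by
  induction hu using parabolic_induction with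
  | one => exact ⟨1, one_mem _, by simpa using h, fun w _ => Relation.ReflTransGen.refl⟩
  | mul_simple u i hu hi hd ih =>
    obtain ⟨u', hu', h1, h2⟩ := ih
    have hlt (w : W) (hw : w ∈ minReps cs K) := bruhatLE_mul_simple hw hu hi hd
    rcases h1.mul_simple_left i with h | h
    · refine ⟨u' * cs.simple i, mul_mem hu' (simple_mem_parabolic cs hi),
        by simpa [mul_assoc] using h, fun w hw => ?_⟩
      rw [← mul_assoc, ← mul_assoc]
      rcases (h2 w hw).mul_simple_left i with h | h
      · exact h
      · exact h.trans (by rw [mul_assoc]; exact hlt w hw)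
    · exact ⟨u', hu', by simpa [mul_assoc] using h, fun w hw => (h2 w hw).trans (hlt w hw)⟩

theorem BruhatLE.exists_mul_inv_le {v v' u : W} (h : BruhatLE cs v (v' * u))
    (hu : u ∈ parabolic cs K) :
    ∃ u' ∈ parabolic cs K, BruhatLE cs (v * u'⁻¹) v' ∧ StablyLE cs K u' u := by
  induction hu using parabolic_induction generalizing v with
  | one => exact ⟨1, one_mem _, by simpa using h, fun w _ => Relation.ReflTransGen.refl⟩
  | mul_simple u i hu hi hd ih =>
    have hlt (w : W) (hw : w ∈ minReps cs K) := bruhatLE_mul_simple hw hu hi hd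
    rw [← mul_assoc] at h
    have h := h.mul_simple_right i
    rw [cs.simple_mul_simple_cancel_right] at h
    rcases h with h | h
    · obtain ⟨u', hu', h1, h2⟩ := ih h
      refine ⟨u' * cs.simple i, mul_mem hu' (simple_mem_parabolic cs hi),
        by simpa [mul_assoc] using h1, fun w hw => ?_⟩
      rw [← mul_assoc, ← mul_assoc]
      rcases (h2 w hw).mul_simple_left i with h | h
      · exact h
      · exact h.trans (by rw [mul_assoc]; exact hlt w hw)
    · obtain ⟨u', hu', h1, h2⟩ := ih h
      exact ⟨u', hu', h1, fun w hw => (h2 w hw).trans (hlt w hw)⟩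

/-- The extension of `⪯` to all pairs `(v', w')`, `(v, w)`. -/
def PairLE (cs : CoxeterSystem M W) (K : Set B) (p' p : W × W) : Prop :=
  ∃ u ∈ parabolic cs K, BruhatLE cs p.1 (p'.1 * u) ∧ BruhatLE cs (p'.2 * u) p.2

/-- With u₂ stably below u, the second components satisfy p.2 u' u₂ ≤ q.2 u₂ ≤ q.2 u ≤ r.2; both of
the first two inequalities need q.2 in W^K. -/
theorem PairLE.trans {p q r : W × W} (hq : q.2 ∈ minReps cs K)
    (hpq : PairLE cs K p q) (hqr : PairLE cs K q r) : PairLE cs K p r := by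
  obtain ⟨u', hu', h1, h2⟩ := hpq
  obtain ⟨u, hu, h3, h4⟩ := hqr
  obtain ⟨u₂, hu₂, h5, h6⟩ := h1.exists_mul_le hu
  refine ⟨u' * u₂, mul_mem hu' hu₂, ?_, ?_⟩
  · rw [← mul_assoc]
    exact h3.trans h5
  · rw [← mul_assoc]
    exact ((h2.mul_parabolic hq hu₂).trans (h6 _ hq)).trans h4

theorem qle_iff_pairLE (p' p : Q cs K) : QLE cs K p' p ↔ PairLE cs K p'.1 p.1 := by
  constructor
  · rintro ⟨u, hu, h1, -, h3⟩
    exact ⟨u, hu, h1, h3⟩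
  · rintro ⟨u, hu, h1, h3⟩
    exact ⟨u, hu, h1, p'.2.2.mul_parabolic p'.2.1 hu, h3⟩

end Bruhat

end CoxeterAtlas

namespace CoxeterAtlas

/-! ### The doubled group: factorizations v♭(w⁻¹)♯ and the comparison of orders. -/

section Main

variable {B W : Type*} [Group W] {M : CoxeterMatrix B} (cs : CoxeterSystem M W) (K : Set B)

theorem flat_simple (i : B) :
    flat K cs (cs.simple i) = (doubleSystem K M).simple (flatIdx K i) :=
  cs.lift_apply_simple _ i

theorem sharp_simple (i : B) :
    sharp K cs (cs.simple i) = (doubleSystem K M).simple (sharpIdx K i) :=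
  cs.lift_apply_simple _ i

theorem length_flat (w : W) : (doubleSystem K M).length (flat K cs w) = cs.length w :=
  length_map cs _ (doubleMatrix_flat K M) (flat_simple cs K) w

theorem length_sharp (w : W) : (doubleSystem K M).length (sharp K cs w) = cs.length w :=
  length_map cs _ (doubleMatrix_sharp K M) (sharp_simple cs K) w

theorem flat_injective : Function.Injective (flat K cs) :=
  map_injective cs _ (doubleMatrix_flat K M) (flat_simple cs K)

theorem sharp_injective : Function.Injective (sharp K cs) :=
  map_injective cs _ (doubleMatrix_sharp K M) (sharp_simple cs K)

theorem flat_mem (w : W) : flat K cs w ∈ parabolic (doubleSystem K M) (flatSet K) :=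
  map_mem_parabolic_range (flat_simple cs K) w

theorem sharp_mem (w : W) : sharp K cs w ∈ parabolic (doubleSystem K M) (sharpSet K) :=
  map_mem_parabolic_range (sharp_simple cs K) w

theorem exists_flat_eq {x : DoubleGroup K M}
    (hx : x ∈ parabolic (doubleSystem K M) (flatSet K)) : ∃ w, flat K cs w = x := by
  rw [flatSet, ← Set.image_univ] at hx
  obtain ⟨w, -, h⟩ := exists_map_eq_of_mem_parabolic_image (flat_simple cs K) hx
  exact ⟨w, h⟩

theorem exists_sharp_eq {x : DoubleGroup K M}
    (hx : x ∈ parabolic (doubleSystem K M) (sharpSet K)) : ∃ w, sharp K cs w = x := by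
  rw [sharpSet, ← Set.image_univ] at hx
  obtain ⟨w, -, h⟩ := exists_map_eq_of_mem_parabolic_image (sharp_simple cs K) hx
  exact ⟨w, h⟩

variable {cs K}

theorem flat_eq_sharp {u : W} (hu : u ∈ parabolic cs K) : flat K cs u = sharp K cs u := by
  induction hu using Subgroup.closure_induction with
  | mem x hx =>
    obtain ⟨k, hk, rfl⟩ := hx
    rw [flat_simple, sharp_simple, (flatIdx_eq_sharpIdx_iff K k k).2 ⟨rfl, hk⟩]
  | one => simp
  | mul x y _ _ hx hy => rw [map_mul, map_mul, hx, hy]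
  | inv x _ hx => rw [map_inv, map_inv, hx]

theorem exists_sharp_eq_of_mem_inter {x : DoubleGroup K M}
    (hx : x ∈ parabolic (doubleSystem K M) (flatSet K))
    (hx' : x ∈ parabolic (doubleSystem K M) (sharpSet K)) :
    ∃ u ∈ parabolic cs K, sharp K cs u = x := by
  have h := mem_parabolic_inter _ hx hx'
  have e : flatSet K ∩ sharpSet K = sharpIdx K '' K := by
    ext a
    constructor
    · rintro ⟨⟨i, rfl⟩, ⟨j, hj⟩⟩
      obtain ⟨rfl, h⟩ := (flatIdx_eq_sharpIdx_iff K i j).1 hj.symm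
      exact ⟨i, h, hj⟩
    · rintro ⟨j, hj, rfl⟩
      exact ⟨⟨j, (flatIdx_eq_sharpIdx_iff K j j).2 ⟨rfl, hj⟩⟩, ⟨j, rfl⟩⟩
  rw [e] at h
  exact exists_map_eq_of_mem_parabolic_image (sharp_simple cs K) h

theorem sharp_mem_flat_iff {w : W} :
    sharp K cs w ∈ parabolic (doubleSystem K M) (flatSet K) ↔ w ∈ parabolic cs K := by
  constructor
  · intro h
    obtain ⟨u, hu, hw⟩ := exists_sharp_eq_of_mem_inter (cs := cs) h (sharp_mem cs K w)
    rwa [← sharp_injective cs K hw]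
  · intro h
    rw [← flat_eq_sharp h]
    exact flat_mem cs K w

/-- A descent in I♭ would be a simple reflection in W̃_{I♭} ∩ W̃_{I♯}, which is the image of W_K,
and would pull back to an element of W_K shortening w⁻¹. -/
theorem isLeftMin_sharp {w : W} (hw : w ∈ minReps cs K) :
    IsLeftMin (doubleSystem K M) (flatSet K) (sharp K cs w⁻¹) := by
  apply isLeftMin_of_forall_not_isLeftDescent
  intro j hj hd
  have hs := simple_mem_parabolic (doubleSystem K M) hj
  have hs' := mem_parabolic_of_isLeftInversion _ (sharp_mem cs K w⁻¹)
    (((doubleSystem K M).isLeftInversion_simple_iff_isLeftDescent _ _).2 hd)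
  obtain ⟨u, hu, h⟩ := exists_sharp_eq_of_mem_inter (cs := cs) hs hs'
  rw [CoxeterSystem.IsLeftDescent, ← h, ← map_mul, length_sharp, length_sharp] at hd
  exact ((mem_minReps_iff cs).1 hw u hu).not_gt hd

variable (cs K) in
/-- The element `v♭ (w⁻¹)♯`. -/
noncomputable def pairElt (v w : W) : DoubleGroup K M :=
  flat K cs v * sharp K cs w⁻¹

theorem pairElt_mul {v w u : W} (hu : u ∈ parabolic cs K) :
    pairElt cs K v (w * u) = pairElt cs K (v * u⁻¹) w := by
  rw [pairElt, pairElt, mul_inv_rev, map_mul, map_mul, flat_eq_sharp (inv_mem hu), mul_assoc]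

theorem exists_minReps_mul (w : W) : ∃ z ∈ minReps cs K, ∃ u ∈ parabolic cs K, w = z * u := by
  obtain ⟨x, hx, y, hy, h⟩ := exists_eq_mul_isLeftMin cs K w⁻¹
  refine ⟨y⁻¹, (inv_mem_minReps_iff cs).2 hy, x⁻¹, inv_mem hx, ?_⟩
  rw [← mul_inv_rev, ← h, inv_inv]

theorem pairElt_inj {v w v' w' : W} (hw : w ∈ minReps cs K) (hw' : w' ∈ minReps cs K)
    (h : pairElt cs K v w = pairElt cs K v' w') : v = v' ∧ w = w' := by
  have h1 : sharp K cs (w'⁻¹ * w) = flat K cs (v'⁻¹ * v) := by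
    rw [pairElt, pairElt, map_inv, map_inv, mul_inv_eq_iff_eq_mul] at h
    rw [map_mul, map_mul, map_inv, map_inv, h]
    group
  have h2 : w'⁻¹ * w ∈ parabolic cs K := by
    rw [← sharp_mem_flat_iff, h1]
    exact flat_mem cs K _
  have h3 : w'⁻¹ * w = 1 :=
    ((mem_minReps_iff cs).1 hw).eq_one h2 (by simpa using (mem_minReps_iff cs).1 hw')
  have h4 : w = w' := (inv_mul_eq_one.1 h3).symm
  subst h4
  exact ⟨flat_injective cs K (mul_right_cancel h), rfl⟩

theorem exists_of_twistedStep {v w : W} {a : DoubleGroup K M} (hw : w ∈ minReps cs K)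
    (h : TwistedStep (doubleSystem K M) (flatSet K) a (pairElt cs K v w)) :
    ∃ v' w', w' ∈ minReps cs K ∧ a = pairElt cs K v' w' ∧ PairLE cs K (v', w') (v, w) := by
  obtain ⟨t, ht, rfl, ⟨htf, hl⟩ | ⟨htf, hl⟩⟩ := h
  · have hinv := (isLeftInversion_mul_iff_of_not_mem (flat_mem cs K v) ht htf).1 ⟨ht, hl⟩
    obtain ⟨τ, hτ, hτt⟩ := exists_isReflection_of_mem_parabolic_range cs _ (sharp_simple cs K)
      hinv.1 (mem_parabolic_of_isLeftInversion _ (sharp_mem cs K w⁻¹) hinv)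
    have hlt := hinv.2
    rw [← hτt, ← map_mul, length_sharp, length_sharp, ← cs.length_inv] at hlt
    simp only [mul_inv_rev, inv_inv, hτ.inv, cs.length_inv] at hlt
    -- The product wτ may leave W^K, so its W_K-factor u is moved to the flat side; u also witnesses
    -- `PairLE`.
    obtain ⟨z, hz, u, hu, hzu⟩ := exists_minReps_mul (cs := cs) (K := K) (w * τ)
    refine ⟨v * u⁻¹, z, hz, ?_, u, hu, ?_, ?_⟩
    · rw [← pairElt_mul hu, ← hzu, pairElt, pairElt, mul_inv_rev, map_mul, hτ.inv, hτt]
      group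
    · simpa using BruhatLE.refl _
    · change BruhatLE cs (z * u) w
      rw [← hzu, bruhatLE_iff_rightLE]
      exact Relation.ReflTransGen.single ⟨τ, trivial, ⟨hτ, hlt⟩, rfl⟩
  · obtain ⟨τ, hτ, rfl⟩ := exists_isReflection_of_mem_parabolic_range cs _ (flat_simple cs K) ht htf
    refine ⟨τ * v, w, hw, by rw [pairElt, pairElt, map_mul, mul_assoc], 1, one_mem _, ?_, ?_⟩
    · have h1 : ¬ (doubleSystem K M).IsLeftInversion (pairElt cs K v w) (flat K cs τ) :=
        fun h => h.2.not_gt hl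
      rw [pairElt, (isLeftMin_sharp hw).isLeftInversion_mul_iff (flat_mem cs K v) ht htf] at h1
      have h2 : ¬ cs.length (τ * v) < cs.length v := fun h => h1 ⟨ht, by
        rwa [← map_mul, length_flat, length_flat]⟩
      have h3 := hτ.length_mul_right_ne v
      simp only [mul_one]
      refine Relation.ReflTransGen.single ⟨τ, hτ, ?_, ?_⟩ <;>
        rw [← mul_assoc, hτ.mul_self, one_mul]
      omega
    · simpa using BruhatLE.refl _

theorem exists_of_doubleLE {v w : W} {a : DoubleGroup K M} (hw : w ∈ minReps cs K)
    (h : DoubleLE K a (pairElt cs K v w)) :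
    ∃ v' w', w' ∈ minReps cs K ∧ a = pairElt cs K v' w' ∧ PairLE cs K (v', w') (v, w) := by
  induction h using Relation.ReflTransGen.head_induction_on with
  | refl =>
    exact ⟨v, w, hw, rfl, 1, one_mem _, by simpa using BruhatLE.refl _,
      by simpa using BruhatLE.refl _⟩
  | head hs _ ih =>
    obtain ⟨v', w', hw', rfl, h'⟩ := ih
    obtain ⟨v'', w'', hw'', rfl, h''⟩ := exists_of_twistedStep hw' hs
    exact ⟨v'', w'', hw'', rfl, h''.trans hw' h'⟩

theorem doubleLE_of_bruhatLE {a b w : W} (hw : w ∈ minReps cs K) (h : BruhatLE cs a b) :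
    DoubleLE K (pairElt cs K b w) (pairElt cs K a w) := by
  induction h with
  | refl => exact Relation.ReflTransGen.refl
  | @tail c b _ hs ih =>
    obtain ⟨t, ht, rfl, hl⟩ := hs
    refine ih.head ⟨flat K cs t, isReflection_map (flat_simple cs K) ht, ?_, Or.inr
      ⟨flat_mem cs K t, ?_⟩⟩
    · rw [pairElt, pairElt, ← mul_assoc, ← map_mul, ← mul_assoc, ht.mul_self, one_mul]
    · rw [pairElt, ← mul_assoc, ← map_mul, ← mul_assoc, ht.mul_self, one_mul,
        (isLeftMin_sharp hw).length_mul (flat_mem cs K _),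
        (isLeftMin_sharp hw).length_mul (flat_mem cs K _), length_flat, length_flat]
      omega

theorem doubleLE_of_rightLE {z w : W} (v : W) (h : RightLE cs (· ∉ parabolic cs K) z w) :
    DoubleLE K (pairElt cs K v z) (pairElt cs K v w) := by
  induction h with
  | refl => exact Relation.ReflTransGen.refl
  | @tail c b _ hs ih =>
    obtain ⟨t, htK, ht, rfl⟩ := hs
    have htr := isReflection_map (sharp_simple cs K) ht.1
    have hv := flat_mem cs K v
    -- Right multiplication of w by t is left multiplication of the product by this conjugate, which
    -- avoids W̃_{I♭} because t avoids W_K.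
    have hmem : flat K cs v * sharp K cs t * (flat K cs v)⁻¹ ∉
        parabolic (doubleSystem K M) (flatSet K) := by
      intro h
      apply htK
      rw [← sharp_mem_flat_iff]
      simpa [mul_assoc] using mul_mem (mul_mem (inv_mem hv) h) hv
    have hinv : (doubleSystem K M).IsLeftInversion (pairElt cs K v b)
        (flat K cs v * sharp K cs t * (flat K cs v)⁻¹) := by
      rw [pairElt, isLeftInversion_mul_iff_of_not_mem hv (htr.conj _) hmem]
      have e : (flat K cs v)⁻¹ * (flat K cs v * sharp K cs t * (flat K cs v)⁻¹) * flat K cs v =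
          sharp K cs t := by group
      rw [e]
      refine ⟨htr, ?_⟩
      rw [← map_mul, length_sharp, length_sharp]
      exact (cs.isLeftInversion_inv_iff.2 ht).2
    refine ih.tail ⟨_, hinv.1, ?_, Or.inl ⟨hmem, hinv.2⟩⟩
    rw [pairElt, pairElt, mul_inv_rev, map_mul, ht.1.inv]
    group

/-- For the converse, the path goes from (v', w') to (v u'⁻¹, w'), the same element as (v, w'u'),
and then to (v, w) since w'u' ≤ w'u ≤ w. -/
theorem doubleLE_iff_pairLE {v w v' w' : W} (hw : w ∈ minReps cs K) (hw' : w' ∈ minReps cs K) :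
    DoubleLE K (pairElt cs K v' w') (pairElt cs K v w) ↔ PairLE cs K (v', w') (v, w) := by
  constructor
  · intro h
    obtain ⟨v'', w'', hw'', h1, h2⟩ := exists_of_doubleLE hw h
    obtain ⟨rfl, rfl⟩ := pairElt_inj hw' hw'' h1
    exact h2
  · rintro ⟨u, hu, h1, h2⟩
    obtain ⟨u', hu', h3, h4⟩ := BruhatLE.exists_mul_inv_le h1 hu
    refine (doubleLE_of_bruhatLE hw' h3).trans ?_
    rw [← pairElt_mul hu']
    exact doubleLE_of_rightLE v (((h4 w' hw').trans h2).rightLE hw)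

theorem nu_eq_pairElt (p : Q cs K) : nu K cs p = pairElt cs K p.1.1 p.1.2 := rfl

theorem nu_injective : Function.Injective (nu K cs) := by
  rintro ⟨⟨v, w⟩, hp⟩ ⟨⟨v', w'⟩, hp'⟩ h
  obtain ⟨rfl, rfl⟩ := pairElt_inj hp.1 hp'.1 h
  rfl

theorem qle_iff_doubleLE (p' p : Q cs K) :
    QLE cs K p' p ↔ DoubleLE K (nu K cs p') (nu K cs p) := by
  rw [qle_iff_pairLE, nu_eq_pairElt, nu_eq_pairElt, doubleLE_iff_pairLE p.2.1 p'.2.1]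

variable (cs K) in
theorem isPartialOrder_qle : IsPartialOrder (Q cs K) (QLE cs K) where
  refl p := (qle_iff_doubleLE p p).2 Relation.ReflTransGen.refl
  trans p q r hpq hqr := (qle_iff_doubleLE p r).2
    (((qle_iff_doubleLE p q).1 hpq).trans ((qle_iff_doubleLE q r).1 hqr))
  antisymm p q hpq hqp := nu_injective
    ((isPartialOrder_twistedLE (doubleSystem K M) (flatSet K)).antisymm _ _
      ((qle_iff_doubleLE p q).1 hpq) ((qle_iff_doubleLE q p).1 hqp))

/-- If v ≤ w, then r = w works. Conversely (r, r) below (v, w) yields v ≤ ru ≤ w. -/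
theorem pairElt_mem_range_nu_iff {v w : W} (hw : w ∈ minReps cs K) :
    pairElt cs K v w ∈ Set.range (nu K cs) ↔
      ∃ r ∈ minReps cs K, DoubleLE K (pairElt cs K r r) (pairElt cs K v w) := by
  constructor
  · rintro ⟨⟨⟨v', w'⟩, hw', hvw⟩, h⟩
    obtain ⟨rfl, rfl⟩ := pairElt_inj hw' hw h
    exact ⟨w', hw', doubleLE_of_bruhatLE hw' hvw⟩
  · rintro ⟨r, hr, h⟩
    obtain ⟨u, -, h1, h2⟩ := (doubleLE_iff_pairLE hw hr).1 h
    exact ⟨⟨(v, w), hw, h1.trans h2⟩, rfl⟩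

theorem exists_eq_pairElt {a b : DoubleGroup K M}
    (ha : a ∈ parabolic (doubleSystem K M) (flatSet K))
    (hb : b ∈ parabolic (doubleSystem K M) (sharpSet K)) :
    ∃ v w, w ∈ minReps cs K ∧ a * b = pairElt cs K v w := by
  obtain ⟨v, rfl⟩ := exists_flat_eq cs K ha
  obtain ⟨w, rfl⟩ := exists_sharp_eq cs K hb
  obtain ⟨z, hz, u, hu, h⟩ := exists_minReps_mul (cs := cs) (K := K) w⁻¹
  refine ⟨v * u⁻¹, z, hz, ?_⟩
  rw [← pairElt_mul hu, ← h, pairElt, inv_inv]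

end Main

end CoxeterAtlas

theorem mainTheorem3 {B : Type*} {W : Type*} [Group W] {M : CoxeterMatrix B}
    (cs : CoxeterSystem M W) (K : Set B) :
    -- `(Q_K, ⪯)` and `(W̃, I♭≤)` are posets
    (IsPartialOrder (CoxeterAtlas.Q cs K) (CoxeterAtlas.QLE cs K) ∧
      IsPartialOrder (CoxeterAtlas.DoubleGroup K M) (CoxeterAtlas.DoubleLE K)) ∧
    -- (1) the map is an isomorphism of posets onto its image
    (Function.Injective (CoxeterAtlas.nu K cs) ∧
      ∀ p' p : CoxeterAtlas.Q cs K, CoxeterAtlas.QLE cs K p' p ↔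
        CoxeterAtlas.DoubleLE K (CoxeterAtlas.nu K cs p') (CoxeterAtlas.nu K cs p)) ∧
    -- (2) description of the image
    Set.range (CoxeterAtlas.nu K cs) =
      {x : CoxeterAtlas.DoubleGroup K M |
        (∃ a ∈ CoxeterAtlas.parabolic (CoxeterAtlas.doubleSystem K M) (CoxeterAtlas.flatSet K),
          ∃ b ∈ CoxeterAtlas.parabolic (CoxeterAtlas.doubleSystem K M) (CoxeterAtlas.sharpSet K),
            x = a * b) ∧
        ∃ r ∈ CoxeterAtlas.minReps cs K, CoxeterAtlas.DoubleLE K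
          (CoxeterAtlas.flat K cs r * CoxeterAtlas.sharp K cs r⁻¹) x} ∧
    -- (3) the image is convex
    (∀ x ∈ Set.range (CoxeterAtlas.nu K cs), ∀ y ∈ Set.range (CoxeterAtlas.nu K cs),
      ∀ z : CoxeterAtlas.DoubleGroup K M, CoxeterAtlas.DoubleLE K x z →
        CoxeterAtlas.DoubleLE K z y → z ∈ Set.range (CoxeterAtlas.nu K cs)) := by
  open CoxeterAtlas in
  refine ⟨⟨isPartialOrder_qle cs K, isPartialOrder_twistedLE _ _⟩,
    ⟨nu_injective, qle_iff_doubleLE⟩, ?_, ?_⟩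
  · ext x
    constructor
    · rintro ⟨p, rfl⟩
      exact ⟨⟨_, flat_mem cs K _, _, sharp_mem cs K _, rfl⟩,
        (pairElt_mem_range_nu_iff p.2.1).1 ⟨p, rfl⟩⟩
    · rintro ⟨⟨a, ha, b, hb, rfl⟩, h⟩
      obtain ⟨v, w, hw, e⟩ := exists_eq_pairElt (cs := cs) ha hb
      rw [e] at h ⊢
      exact (pairElt_mem_range_nu_iff hw).2 h
  · rintro x ⟨p, rfl⟩ y ⟨q, rfl⟩ z hxz hzy
    -- Lying below y already puts z in the form `pairElt v w`; lying above x supplies the element r.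
    obtain ⟨v, w, hw, rfl, -⟩ := exists_of_doubleLE q.2.1 hzy
    obtain ⟨r, hr, h⟩ := (pairElt_mem_range_nu_iff p.2.1).1 ⟨p, rfl⟩
    exact (pairElt_mem_range_nu_iff hw).2 ⟨r, hr, h.trans hxz⟩
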